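/- Let $V$ be a Minkowski plane, i.e. a two-dimensional real vector space with a norm $\|\cdot\|$, and fix a translation-invariant area on $V$ (unique up to the choice of the unit of area). For non-zero $x,y\in V$ say that $x$ is normal to $y$ if $\|x\|\le\|x+\lambda y\|$ for all $\lambda\in\mathbf R$; the plane is called Radon if normality is a symmetric relation. For a convex polygon $P$ (with interior points) let $|P|$ denote its area and $\operatorname{per}(P)$ its perimeter, i.e. the sum of the lengths of its sides in the norm. A polygon $P$ is circumscribed about the circle with centre $c$ and radius $\rho>0$ if the disc $D=\{x:\|x-c\|\le\rho\}$ is contained in $P$ and every side of $P$ touches $D$. A convex $n$-gon circumscribed about this circle is allowed to have sides that degenerate to points: it is a bounded set that is the intersection of $n$ half-planes containing $D$ whose bounding lines are $n$ different supporting lines of $D$. The following statements are equivalent: 1. the Minkowski plane is Radon; 2. there is $\gamma>0$ such that $\rho\operatorname{per}(P)=\gamma\,|P|$ for all $\rho>0$ and every convex polygon $P$ circumscribed about a circle of radius $\rho$; 3. there are $\gamma>0$ and $n\ge 3$ such that $\rho\operatorname{per}(P)=\gamma\,|P|$ for all $\rho>0$ and every convex $n$-gon $P$ circumscribed about a circle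 of radius $\rho$; 4. there is $\gamma>0$ such that $\rho\operatorname{per}(P)=\gamma\,|P|$ for all $\rho>0$ and every triangle $P$ circumscribed about a circle of radius $\rho$. -/

import Mathlib

open MeasureTheory Metric Set Bornology

noncomputable section

namespace MinkowskiPlane

variable {V : Type*} [NormedAddCommGroup V] [NormedSpace ℝ V]

/-- `x` is normal to `y` (Birkhoff orthogonality), a relation between non-zero vectors. -/
def IsNormalTo (x y : V) : Prop :=
  x ≠ 0 ∧ y ≠ 0 ∧ ∀ t : ℝ, ‖x‖ ≤ ‖x + t • y‖

/-- The norm is a Radon norm: normality is a symmetric relation. -/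
def IsRadon (V : Type*) [NormedAddCommGroup V] [NormedSpace ℝ V] : Prop :=
  ∀ x y : V, IsNormalTo x y → IsNormalTo y x

/-- Closed half-planes. -/
def IsHalfPlane (H : Set V) : Prop :=
  ∃ (f : V →L[ℝ] ℝ) (b : ℝ), f ≠ 0 ∧ H = {x | f x ≤ b}

/-- `H` is a closed half-plane that contains `K` and whose bounding line meets `K`, so that the
bounding line is a supporting line of `K`. -/
def IsSupportingHalfPlane (K H : Set V) : Prop :=
  ∃ (f : V →L[ℝ] ℝ) (b : ℝ), f ≠ 0 ∧ H = {x | f x ≤ b} ∧ K ⊆ H ∧ ∃ x ∈ K, f x = b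

/-- Convex polygons (with interior): bounded intersections of finitely many closed half-planes
that have an interior point. -/
def IsConvexPolygon (P : Set V) : Prop :=
  IsBounded P ∧ (interior P).Nonempty ∧
    ∃ 𝓗 : Set (Set V), 𝓗.Finite ∧ (∀ H ∈ 𝓗, IsHalfPlane H) ∧ P = ⋂₀ 𝓗

/-- Triangles (with interior): convex hulls of three affinely independent points. -/
def IsTriangle (P : Set V) : Prop :=
  ∃ p : Fin 3 → V, AffineIndependent ℝ p ∧ P = convexHull ℝ (range p)

/-- The (non-degenerate) sides of `P`: the intersections of `P` with its supporting lines that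
have more than one point. For a convex polygon these are finitely many segments. -/
def sides (P : Set V) : Set (Set V) :=
  {S | S.Nontrivial ∧ ∃ f : V →L[ℝ] ℝ, f ≠ 0 ∧ S = {x ∈ P | ∀ y ∈ P, f y ≤ f x}}

/-- The perimeter, in the norm, of a convex polygon: the sum of the lengths of its sides.
The length of a segment is its diameter. -/
def perimeter (P : Set V) : ℝ :=
  ∑ᶠ S ∈ sides P, diam S

/-- `P` is circumscribed about the circle with centre `c` and radius `ρ`: the disc lies in `P`
and every side of `P` touches it. -/
def IsCircumscribed (P : Set V) (c : V) (ρ : ℝ) : Prop :=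
  closedBall c ρ ⊆ P ∧ ∀ S ∈ sides P, (S ∩ closedBall c ρ).Nonempty

/-- `P` is a convex `n`-gon circumscribed about the circle with centre `c` and radius `ρ`, where a
side may degenerate to a point: `P` is bounded, and it is the intersection of `n` half-planes
bounded by `n` different supporting lines of the disc. (The `n` sides are the intersections of `P`
with these lines. Two supporting half-planes of a disc are different if and only if their bounding
lines are.) -/
def IsCircumscribedNGon (n : ℕ) (P : Set V) (c : V) (ρ : ℝ) : Prop :=
  IsBounded P ∧ ∃ 𝓗 : Set (Set V), 𝓗.Finite ∧ 𝓗.ncard = n ∧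
    (∀ H ∈ 𝓗, IsSupportingHalfPlane (closedBall c ρ) H) ∧ P = ⋂₀ 𝓗

end MinkowskiPlane

end

/-! The area form of a basis `e` identifies the dual plane with `V` through the linear map
`dualToPlane e`, written J here; it satisfies g(Jg) = 0 and f(Jg) = -g(Jf). A nonzero x is normal to
Jg exactly when |g x| = ‖g‖‖x‖, so the Radon property compares ‖Jg‖ with the dual norm ‖g‖: it holds
if and only if ‖Jg‖ = k‖g‖ for a constant k. If the norms are proportional, the symmetry is
immediate. Conversely (`IsRadon.exists_norm_dualToPlane_eq`), the symmetry makes the logarithmic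
derivatives of the two norms agree almost everywhere along lines, so their ratio is constant.

Write a polygon as the set where g(x - c) ≤ 1 for all g in a finite set G. The side of g is a
translate of the segment from 0 to τ_g Jg, so the perimeter is Σ τ_g ‖Jg‖. Cutting the polygon into
triangles with apex c gives the area κ Σ τ_g, where κ is the area of `refTriangle e`. Sides that
touch the circle have ‖g‖ = 1/ρ, hence proportional norms give the area formula side by side. Moving
the apex yields the closing relation Σ τ_g g = 0.

For the return from n-gons to the Radon property, put h(g) = ‖Jg‖ - γκ‖g‖; the formula says Σ τ_g
h(g) = 0. Letting n - 3 of the sides approach one of the other three (`sum_eq_zero_of_nGon`) reduces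
this to triangles, whose τ are determined up to scale by the closing relation. So h(f₁) + h(f₂) +
h(f₁ + f₂) = 0 for independent f₁, f₂. Since h is even, it takes equal values on independent
functionals, and homogeneity then forces h = 0 (`norm_dualToPlane_eq_of_nGon`). -/

noncomputable section

namespace MinkowskiPlane

/-! ### Duality by the area form, and normality in terms of functionals -/

section

variable {V : Type*} [NormedAddCommGroup V] [NormedSpace ℝ V]

/-- The isomorphism from the dual of a plane with basis `e` to the plane that is induced by the
area form of `e`; it sends a functional to a vector of its kernel. -/
def dualToPlane (e : Module.Basis (Fin 2) ℝ V) (g : V →L[ℝ] ℝ) : V :=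
  g (e 0) • e 1 - g (e 1) • e 0

variable (e : Module.Basis (Fin 2) ℝ V)

lemma dualToPlane_add (f g : V →L[ℝ] ℝ) :
    dualToPlane e (f + g) = dualToPlane e f + dualToPlane e g := by
  simp only [dualToPlane, add_apply]
  module

lemma dualToPlane_smul (t : ℝ) (g : V →L[ℝ] ℝ) :
    dualToPlane e (t • g) = t • dualToPlane e g := by
  simp only [dualToPlane, smul_apply, smul_eq_mul]
  module

lemma dualToPlane_neg (g : V →L[ℝ] ℝ) : dualToPlane e (-g) = -dualToPlane e g := by
  rw [← neg_one_smul ℝ g, dualToPlane_smul, neg_one_smul]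

lemma dualToPlane_sub (f g : V →L[ℝ] ℝ) :
    dualToPlane e (f - g) = dualToPlane e f - dualToPlane e g := by
  rw [sub_eq_add_neg, dualToPlane_add, dualToPlane_neg, sub_eq_add_neg]

lemma apply_dualToPlane_swap (f g : V →L[ℝ] ℝ) :
    f (dualToPlane e g) = -g (dualToPlane e f) := by
  simp only [dualToPlane, map_sub, map_smul, smul_eq_mul]
  ring

@[simp]
lemma apply_dualToPlane_self (g : V →L[ℝ] ℝ) : g (dualToPlane e g) = 0 := by
  have := apply_dualToPlane_swap e g g
  linarith

lemma eq_coords (x : V) : x = e.repr x 0 • e 0 + e.repr x 1 • e 1 := by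
  rw [← Fin.sum_univ_two (fun i ↦ e.repr x i • e i), e.sum_repr]

/-- Cramer's rule. -/
lemma cramer (f g : V →L[ℝ] ℝ) (x : V) :
    f (dualToPlane e g) • x = f x • dualToPlane e g - g x • dualToPlane e f := by
  rw [eq_coords e x]
  simp only [dualToPlane, map_sub, map_add, map_smul, smul_eq_mul]
  module

lemma dualToPlane_ne_zero {g : V →L[ℝ] ℝ} (hg : g ≠ 0) : dualToPlane e g ≠ 0 := by
  intro h
  apply hg
  ext x
  obtain ⟨h1, h0⟩ : g (e 0) = 0 ∧ g (e 1) = 0 := by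
    have := congrArg e.repr h
    constructor
    · simpa [dualToPlane] using DFunLike.congr_fun this 1
    · simpa [dualToPlane] using DFunLike.congr_fun this 0
  rw [eq_coords e x]
  simp [h1, h0]

lemma dualToPlane_pos {g : V →L[ℝ] ℝ} (hg : g ≠ 0) : 0 < ‖dualToPlane e g‖ :=
  norm_pos_iff.2 (dualToPlane_ne_zero e hg)

/-- If two functionals have a common non-zero zero, they are proportional. -/
lemma exists_eq_smul_of_apply_dualToPlane {f g : V →L[ℝ] ℝ} (hg : g ≠ 0)
    (h : f (dualToPlane e g) = 0) : ∃ t : ℝ, f = t • g := by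
  obtain ⟨v, hv⟩ : ∃ v, g v ≠ 0 := by
    by_contra! H
    exact hg (by ext x; simp [H x])
  refine ⟨f v / g v, ?_⟩
  by_contra hne
  refine dualToPlane_ne_zero e (sub_ne_zero.2 hne) ?_
  have h1 := cramer e f g v
  rw [h, zero_smul, eq_comm, sub_eq_zero] at h1
  rw [dualToPlane_sub, dualToPlane_smul, sub_eq_zero, div_eq_inv_mul, mul_smul, h1, smul_smul,
    inv_mul_cancel₀ hv, one_smul]

lemma apply_dualToPlane_eq_zero_of_common_zero {f g : V →L[ℝ] ℝ} {y : V} (hy : y ≠ 0)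
    (hf : f y = 0) (hg : g y = 0) : f (dualToPlane e g) = 0 := by
  have h := cramer e f g y
  rw [hf, hg, zero_smul, zero_smul, sub_zero] at h
  exact (smul_eq_zero.1 h).resolve_right hy

lemma exists_eq_smul_of_common_zero (e : Module.Basis (Fin 2) ℝ V) {f g : V →L[ℝ] ℝ} {y : V}
    (hy : y ≠ 0) (hf : f y = 0) (hg : g y = 0) (hg0 : g ≠ 0) : ∃ t : ℝ, f = t • g :=
  exists_eq_smul_of_apply_dualToPlane e hg0 (apply_dualToPlane_eq_zero_of_common_zero e hy hf hg)

/-- Every vector of the plane comes from a functional. -/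
lemma dualToPlane_surjective [FiniteDimensional ℝ V] (x : V) :
    ∃ g : V →L[ℝ] ℝ, dualToPlane e g = x := by
  refine ⟨LinearMap.toContinuousLinearMap (e.repr x 1 • e.coord 0 - e.repr x 0 • e.coord 1), ?_⟩
  conv_rhs => rw [eq_coords e x]
  simp [dualToPlane]
  abel

lemma exists_eq_smul_dualToPlane [FiniteDimensional ℝ V] {g : V →L[ℝ] ℝ} (hg : g ≠ 0) {y : V}
    (h : g y = 0) : ∃ t : ℝ, y = t • dualToPlane e g := by
  obtain ⟨f, rfl⟩ := dualToPlane_surjective e y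
  rw [apply_dualToPlane_swap, neg_eq_zero] at h
  obtain ⟨t, rfl⟩ := exists_eq_smul_of_apply_dualToPlane e hg h
  exact ⟨t, dualToPlane_smul e t g⟩

/-- The line through x in the direction Jg is a level line of g, and its distance from the origin is
|g x| / ‖g‖; normality says that x attains this distance. -/
lemma isNormalTo_dualToPlane_iff [FiniteDimensional ℝ V] {g : V →L[ℝ] ℝ} (hg : g ≠ 0) {x : V}
    (hx : x ≠ 0) : IsNormalTo x (dualToPlane e g) ↔ |g x| = ‖g‖ * ‖x‖ := by
  have hle : |g x| ≤ ‖g‖ * ‖x‖ := g.le_opNorm x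
  constructor
  · rintro ⟨-, -, h⟩
    refine le_antisymm hle ?_
    have hgx : g x ≠ 0 := by
      intro h0
      obtain ⟨t, rfl⟩ := exists_eq_smul_dualToPlane e hg h0
      have := h (-t)
      rw [← add_smul, add_neg_cancel, zero_smul, norm_zero] at this
      exact hx (norm_le_zero_iff.1 this)
    have hx' := norm_pos_iff.2 hx
    rw [← le_div_iff₀ hx']
    refine g.opNorm_le_bound (by positivity) fun z ↦ ?_
    obtain ⟨t, ht⟩ := exists_eq_smul_dualToPlane e hg (y := z - (g z / g x) • x)
      (by simp [hgx])
    rcases eq_or_ne (g z) 0 with hz | hz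
    · rw [hz, norm_zero]; positivity
    -- The parameter is chosen so that the point on the line is the multiple of z at which g takes
    -- the value g x.
    have h1 := h ((g x / g z) * t)
    have h2 : x + ((g x / g z) * t) • dualToPlane e g = (g x / g z) • z := by
      rw [mul_smul, ← ht, smul_sub, smul_smul, div_mul_div_cancel₀ hz, div_self hgx, one_smul]
      abel
    rw [h2, norm_smul, norm_div, Real.norm_eq_abs, Real.norm_eq_abs] at h1
    rw [Real.norm_eq_abs, div_mul_eq_mul_div, le_div_iff₀ hx']
    rw [div_mul_eq_mul_div, le_div_iff₀ (abs_pos.2 hz)] at h1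
    linarith
  · intro h
    refine ⟨hx, dualToPlane_ne_zero e hg, fun t ↦ ?_⟩
    have h1 := g.le_opNorm (x + t • dualToPlane e g)
    rw [map_add, map_smul, apply_dualToPlane_self, smul_zero, add_zero, Real.norm_eq_abs, h] at h1
    exact le_of_mul_le_mul_left h1 (norm_pos_iff.2 hg)

/-- Normality of Jf to Jg now reads |g(Jf)| = k‖f‖‖g‖, which is symmetric in f and g. -/
lemma isRadon_of_norm_dualToPlane [FiniteDimensional ℝ V] {k : ℝ}
    (h : ∀ g : V →L[ℝ] ℝ, ‖dualToPlane e g‖ = k * ‖g‖) : IsRadon V := by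
  intro x y hxy
  have hx := hxy.1
  have hy := hxy.2.1
  obtain ⟨f, rfl⟩ := dualToPlane_surjective e x
  obtain ⟨g, rfl⟩ := dualToPlane_surjective e y
  have hf : f ≠ 0 := by rintro rfl; exact hx (by simp [dualToPlane])
  have hg : g ≠ 0 := by rintro rfl; exact hy (by simp [dualToPlane])
  rw [isNormalTo_dualToPlane_iff e hg hx] at hxy
  rw [isNormalTo_dualToPlane_iff e hf hy, apply_dualToPlane_swap, abs_neg, hxy, h, h]
  ring

/-- In a Radon plane, `f` and `g` norm each other's images simultaneously. -/
lemma IsRadon.abs_apply_dualToPlane [FiniteDimensional ℝ V] (hR : IsRadon V) {f g : V →L[ℝ] ℝ}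
    (hf : f ≠ 0) (hg : g ≠ 0) (h : |g (dualToPlane e f)| = ‖g‖ * ‖dualToPlane e f‖) :
    |f (dualToPlane e g)| = ‖f‖ * ‖dualToPlane e g‖ := by
  rw [← isNormalTo_dualToPlane_iff e hg (dualToPlane_ne_zero e hf)] at h
  exact (isNormalTo_dualToPlane_iff e hf (dualToPlane_ne_zero e hg)).1 (hR _ _ h)

end

/-! ### Radon planes: norm and antinorm are proportional -/

section

variable {V : Type*} [NormedAddCommGroup V] [NormedSpace ℝ V]

lemma lipschitzWith_norm_line {E : Type*} [NormedAddCommGroup E] [NormedSpace ℝ E] (a b : E) :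
    LipschitzWith ‖b‖₊ fun t : ℝ ↦ ‖a + t • b‖ := by
  refine LipschitzWith.of_dist_le_mul fun s t ↦ ?_
  rw [Real.dist_eq, Real.dist_eq, coe_nnnorm]
  refine (abs_norm_sub_norm_le _ _).trans_eq ?_
  rw [add_sub_add_left_eq_sub, ← sub_smul, norm_smul, Real.norm_eq_abs, mul_comm]

lemma _root_.LipschitzOnWith.inv_of_le {K : NNReal} {f : ℝ → ℝ} {s : Set ℝ} {m : ℝ} (hm : 0 < m)
    (hf : LipschitzOnWith K f s) (hle : ∀ x ∈ s, m ≤ f x) :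
    LipschitzOnWith (K * Real.toNNReal (m⁻¹ ^ 2)) f⁻¹ s := by
  refine LipschitzOnWith.of_dist_le_mul fun x hx y hy ↦ ?_
  have h1 := hle x hx
  have h2 := hle y hy
  have h3 := hf.dist_le_mul x hx y hy
  have hx0 : 0 < f x := by linarith
  have hy0 : 0 < f y := by linarith
  rw [Pi.inv_apply, Pi.inv_apply, dist_inv_inv₀ hx0.ne' hy0.ne', NNReal.coe_mul,
    Real.coe_toNNReal _ (by positivity), Real.norm_of_nonneg hx0.le, Real.norm_of_nonneg hy0.le,
    div_le_iff₀ (by positivity)]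
  have h4 : 1 ≤ m⁻¹ ^ 2 * (f x * f y) := by
    have : m * m ≤ f x * f y := mul_le_mul h1 h2 hm.le hx0.le
    rw [inv_pow, inv_mul_eq_div, le_div_iff₀ (by positivity)]
    nlinarith
  calc dist (f x) (f y) ≤ K * dist x y := h3
    _ ≤ (K * dist x y) * (m⁻¹ ^ 2 * (f x * f y)) := le_mul_of_one_le_right (by positivity) h4
    _ = _ := by ring

variable (e : Module.Basis (Fin 2) ℝ V)

/-- Both norms are Lipschitz along the line, so the quotient is absolutely continuous, and it
suffices that its derivative vanishes almost everywhere. Where both are differentiable, a functional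
g norming Jf gives the derivative of the numerator; by the Radon property f in turn attains its norm
at Jg, which gives the derivative of the denominator. -/
lemma IsRadon.norm_dualToPlane_div_eq_of_line [FiniteDimensional ℝ V] (hR : IsRadon V)
    (a b : V →L[ℝ] ℝ) (hab : ∀ t : ℝ, a + t • b ≠ 0) :
    ‖dualToPlane e a‖ / ‖a‖ = ‖dualToPlane e (a + b)‖ / ‖a + b‖ := by
  set M : ℝ → ℝ := fun t ↦ ‖dualToPlane e a + t • dualToPlane e b‖ with hM
  set A : ℝ → ℝ := fun t ↦ ‖a + t • b‖ with hA
  have hMl := lipschitzWith_norm_line (dualToPlane e a) (dualToPlane e b)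
  have hAl := lipschitzWith_norm_line a b
  have hApos : ∀ t, 0 < A t := fun t ↦ norm_pos_iff.2 (hab t)
  -- The minimum of `A` is a positive lower bound, which makes the reciprocal Lipschitz on the
  -- interval.
  obtain ⟨t₀, -, ht₀⟩ := isCompact_Icc.exists_isMinOn (nonempty_uIcc (a := (0 : ℝ)) (b := 1))
    hAl.continuous.continuousOn
  have hAC : AbsolutelyContinuousOnInterval (M * A⁻¹) 0 1 :=
    (hMl.lipschitzOnWith.absolutelyContinuousOnInterval).mul
      ((hAl.lipschitzOnWith.inv_of_le (hApos t₀) ht₀).absolutelyContinuousOnInterval)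
  have hder : ∀ᵐ t, t ∈ uIcc (0 : ℝ) 1 → HasDerivAt (M * A⁻¹) 0 t := by
    filter_upwards [hMl.ae_differentiableAt_real, hAl.ae_differentiableAt_real] with t hMt hAt _
    have hMt := hMt.hasDerivAt
    have hAt := hAt.hasDerivAt
    set f := a + t • b with hf
    have hJf : dualToPlane e a + t • dualToPlane e b = dualToPlane e f := by
      rw [hf, dualToPlane_add, dualToPlane_smul]
    have hMt0 : M t = ‖dualToPlane e f‖ := by rw [hM, ← hJf]
    obtain ⟨g, hg1, hg2⟩ := exists_dual_vector ℝ (dualToPlane e f)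
      (dualToPlane_pos e (hab t)).ne'
    have hg0 : g ≠ 0 := by rintro rfl; simp at hg1
    replace hg2 : g (dualToPlane e f) = ‖dualToPlane e f‖ := by simpa using hg2
    have hfg := hR.abs_apply_dualToPlane e (hab t) hg0
      (by rw [hg2, hg1, one_mul, abs_of_nonneg (norm_nonneg _)])
    have hfg' : -(f (dualToPlane e g)) = ‖f‖ * ‖dualToPlane e g‖ := by
      rw [← hfg, ← apply_dualToPlane_swap, hg2, apply_dualToPlane_swap e f g, abs_neg, hg2,
        abs_of_nonneg (norm_nonneg _)]
    have hd1 : deriv M t = g (dualToPlane e b) := by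
      -- Since ‖g‖ = 1, g bounds `M` from below by an affine function, with equality at `t`; the
      -- slopes must agree.
      have hmin : IsLocalMin (fun s : ℝ ↦ M s - (g (dualToPlane e a) + s * g (dualToPlane e b)))
          t := by
        refine Filter.Eventually.of_forall fun s ↦ ?_
        have h1 : g (dualToPlane e a + t • dualToPlane e b) = M t := by
          rw [hMt0, hJf, hg2]
        have h2 : g (dualToPlane e a + s • dualToPlane e b) ≤ M s := by
          refine (le_abs_self _).trans ((g.le_opNorm _).trans ?_)
          rw [hg1, one_mul]
        simp only [map_add, map_smul, smul_eq_mul] at h1 h2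
        dsimp only
        linarith
      have := hmin.hasDerivAt_eq_zero
        (hMt.sub ((hasDerivAt_mul_const (g (dualToPlane e b))).const_add _))
      linarith
    have hd2 : deriv A t * ‖dualToPlane e g‖ = -(b (dualToPlane e g)) := by
      have hmin : IsLocalMin (fun s : ℝ ↦ A s * ‖dualToPlane e g‖ -
          (-(a (dualToPlane e g)) + s * -(b (dualToPlane e g)))) t := by
        refine Filter.Eventually.of_forall fun s ↦ ?_
        have h1 : -((a + t • b) (dualToPlane e g)) = A t * ‖dualToPlane e g‖ := hfg'
        have h2 : -((a + s • b) (dualToPlane e g)) ≤ A s * ‖dualToPlane e g‖ :=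
          (neg_le_abs _).trans ((a + s • b).le_opNorm _)
        simp only [add_apply, smul_apply, smul_eq_mul] at h1 h2
        dsimp only
        linarith
      have := hmin.hasDerivAt_eq_zero
        ((hAt.mul_const _).sub ((hasDerivAt_mul_const (-(b (dualToPlane e g)))).const_add _))
      linarith
    have hprod : HasDerivAt (M * A⁻¹) (deriv M t * A⁻¹ t + M t * (-deriv A t / A t ^ 2)) t :=
      hMt.mul (hAt.inv (hApos t).ne')
    have hA' := hApos t
    have hg' := dualToPlane_pos e hg0
    have key : deriv M t * A t = M t * deriv A t := by
      apply mul_right_cancel₀ hg'.ne'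
      have h3 : A t * ‖dualToPlane e g‖ = M t := by
        rw [hMt0, ← hg2, apply_dualToPlane_swap, hfg']
      have h4 : deriv A t * ‖dualToPlane e g‖ = deriv M t := by
        rw [hd1, hd2, apply_dualToPlane_swap, neg_neg]
      rw [mul_assoc, h3, mul_assoc, h4, mul_comm]
    have h0 : deriv M t * A⁻¹ t + M t * (-deriv A t / A t ^ 2) = 0 := by
      rw [Pi.inv_apply]
      field_simp
      linarith
    rwa [h0] at hprod
  obtain ⟨C, hC⟩ := hAC.const_of_ae_hasDerivAt_zero hder
  have h0 := hC 0 left_mem_uIcc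
  have h1 := hC 1 right_mem_uIcc
  simp only [hM, hA, Pi.mul_apply, Pi.inv_apply, zero_smul, add_zero, one_smul,
    ← dualToPlane_add] at h0 h1
  rw [div_eq_mul_inv, div_eq_mul_inv, h0, h1]

/-- In a Radon plane, the norm and the antinorm are proportional. -/
lemma IsRadon.exists_norm_dualToPlane_eq [FiniteDimensional ℝ V] (hR : IsRadon V) :
    ∃ k : ℝ, 0 < k ∧ ∀ g : V →L[ℝ] ℝ, ‖dualToPlane e g‖ = k * ‖g‖ := by
  have key : ∀ f g : V →L[ℝ] ℝ, f ≠ 0 → g ≠ 0 →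
      ‖dualToPlane e f‖ / ‖f‖ = ‖dualToPlane e g‖ / ‖g‖ := by
    intro f g hf hg
    by_cases h : f (dualToPlane e g) = 0
    · obtain ⟨t, rfl⟩ := exists_eq_smul_of_apply_dualToPlane e hg h
      have ht : t ≠ 0 := by rintro rfl; simp at hf
      rw [dualToPlane_smul, norm_smul, norm_smul, mul_div_mul_left _ _ (norm_ne_zero_iff.2 ht)]
    -- For independent functionals the line through them misses 0: a zero would force t = 1 when
    -- evaluated at Jg, and this fails at Jf.
    · have := hR.norm_dualToPlane_div_eq_of_line e f (g - f) fun t ht ↦ by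
        have h1 : (f + t • (g - f)) (dualToPlane e g) = 0 := by rw [ht]; rfl
        have h2 : (f + t • (g - f)) (dualToPlane e f) = 0 := by rw [ht]; rfl
        simp only [add_apply, smul_apply, sub_apply, apply_dualToPlane_self, smul_eq_mul] at h1 h2
        have h3 : t = 1 := by
          apply mul_right_cancel₀ h
          linarith
        rw [apply_dualToPlane_swap, h3] at h2
        exact h (by linarith)
      rwa [add_sub_cancel] at this
  obtain ⟨f, hf⟩ := dualToPlane_surjective e (e 0)
  have hf0 : f ≠ 0 := by
    rintro rfl
    exact e.ne_zero 0 (by rw [← hf]; simp [dualToPlane])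
  refine ⟨‖dualToPlane e f‖ / ‖f‖, div_pos (dualToPlane_pos e hf0) (norm_pos_iff.2 hf0),
    fun g ↦ ?_⟩
  rcases eq_or_ne g 0 with rfl | hg
  · simp [dualToPlane]
  · rw [key f g hf0 hg, div_mul_cancel₀ _ (norm_ne_zero_iff.2 hg)]

end

/-! ### Polyhedra, their faces and the perimeter -/

section

variable {V : Type*} [NormedAddCommGroup V] [NormedSpace ℝ V]

/-- The polyhedron with centre `c` whose facets have the normal functionals in `G`. -/
def poly (G : Finset (V →L[ℝ] ℝ)) (c : V) : Set V := {x | ∀ g ∈ G, g (x - c) ≤ 1}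

/-- The face of `poly G c` with normal functional `g`. -/
def face (G : Finset (V →L[ℝ] ℝ)) (c : V) (g : V →L[ℝ] ℝ) : Set V :=
  {x ∈ poly G c | g (x - c) = 1}

variable {G : Finset (V →L[ℝ] ℝ)} {c : V}

lemma isClosed_poly : IsClosed (poly G c) := by
  simp only [poly, ofPred_forall]
  exact isClosed_biInter fun g _ ↦ isClosed_le (by fun_prop) continuous_const

lemma convex_poly : Convex ℝ (poly G c) := by
  intro x hx y hy a b ha hb hab g hg
  have h1 := hx g hg
  have h2 := hy g hg
  rw [map_sub] at h1 h2 ⊢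
  rw [map_add, map_smul, map_smul, smul_eq_mul, smul_eq_mul]
  have : a * g x + b * g y ≤ a * (1 + g c) + b * (1 + g c) := by gcongr <;> linarith
  rw [← add_mul, hab] at this
  linarith

lemma center_mem_poly : c ∈ poly G c := fun g _ ↦ by simp

lemma isOpen_strict_poly : IsOpen {x : V | ∀ g ∈ G, g (x - c) < 1} := by
  simp only [ofPred_forall]
  exact isOpen_biInter_finset fun g _ ↦ isOpen_lt (by fun_prop) continuous_const

/-- Otherwise the whole ray from c in the direction v would stay in the polyhedron. -/
lemma eq_zero_of_bounded_poly (hb : IsBounded (poly G c)) {v : V} (hv : ∀ g ∈ G, g v ≤ 0) :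
    v = 0 := by
  by_contra hne
  obtain ⟨R, hR⟩ := hb.subset_closedBall c
  have hn := norm_pos_iff.2 hne
  have hmem : c + ((|R| + 1) / ‖v‖) • v ∈ poly G c := by
    intro g hg
    rw [add_sub_cancel_left, map_smul, smul_eq_mul]
    have := mul_nonneg_of_nonpos_of_nonpos (hv g hg)
      (neg_nonpos.2 (by positivity : 0 ≤ (|R| + 1) / ‖v‖))
    linarith
  have h1 := hR hmem
  rw [mem_closedBall, dist_self_add_left, norm_smul, Real.norm_of_nonneg (by positivity),
    div_mul_cancel₀ _ hn.ne'] at h1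
  have := le_abs_self R
  linarith

lemma exists_lt_apply_of_isOpen {f : V →L[ℝ] ℝ} (hf : f ≠ 0) {O : Set V} (hO : IsOpen O) {x : V}
    (hx : x ∈ O) : ∃ y ∈ O, f x < f y := by
  by_contra! H
  have hmax : IsLocalMax f x := Filter.eventually_of_mem (hO.mem_nhds hx) H
  exact hf (hmax.hasFDerivAt_eq_zero f.hasFDerivAt)

lemma face_eq_argmax {g : V →L[ℝ] ℝ} (hg : g ∈ G) (hne : (face G c g).Nonempty) :
    face G c g = {x ∈ poly G c | ∀ y ∈ poly G c, g y ≤ g x} := by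
  ext x
  refine and_congr_right fun hx ↦ ⟨fun h y hy ↦ ?_, fun h ↦ ?_⟩
  · have := hy g hg
    rw [map_sub] at this h
    linarith
  · obtain ⟨z, hz, hz1⟩ := hne
    refine le_antisymm (hx g hg) ?_
    have := h z hz
    rw [map_sub] at hz1 ⊢
    linarith

lemma face_injOn (e : Module.Basis (Fin 2) ℝ V) (h0 : ∀ g ∈ G, g ≠ 0) :
    InjOn (face G c) {g | g ∈ G ∧ (face G c g).Nontrivial} := by
  rintro g ⟨hg, hn⟩ g' - heq
  obtain ⟨p, hp, q, hq, hpq⟩ := hn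
  have hp' : p ∈ face G c g' := heq ▸ hp
  have hq' : q ∈ face G c g' := heq ▸ hq
  obtain ⟨t, rfl⟩ := exists_eq_smul_of_common_zero e (f := g') (g := g) (sub_ne_zero.2 hpq)
    (by rw [← sub_sub_sub_cancel_right p q c, map_sub, hp'.2, hq'.2, sub_self])
    (by rw [← sub_sub_sub_cancel_right p q c, map_sub, hp.2, hq.2, sub_self]) (h0 g hg)
  have := hp'.2
  rw [smul_apply, hp.2, smul_eq_mul, mul_one] at this
  rw [this, one_smul]

/-- The midpoint of two points of a side must make some constraint g active, since a linear
functional has no maximum at an interior point. Then g is active at both points too, so the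
functional defining the side is a multiple of g, positive because c is strictly inside. -/
lemma sides_poly (e : Module.Basis (Fin 2) ℝ V) (h0 : ∀ g ∈ G, g ≠ 0) :
    sides (poly G c) = face G c '' {g | g ∈ G ∧ (face G c g).Nontrivial} := by
  ext S
  constructor
  · rintro ⟨hS, f, hf, rfl⟩
    obtain ⟨p, ⟨hp, hpm⟩, q, ⟨hq, hqm⟩, hpq⟩ := hS
    have hfpq : f p = f q := le_antisymm (hqm p hp) (hpm q hq)
    set m := midpoint ℝ p q with hm
    have hfm : ∀ g : V →L[ℝ] ℝ, g (m - c) = (g (p - c) + g (q - c)) / 2 := by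
      intro g
      rw [hm, midpoint_eq_smul_add]
      simp only [map_sub, map_smul, map_add, smul_eq_mul, invOf_eq_inv]
      ring
    have hmP : m ∈ poly G c := fun g hg ↦ by
      have := hp g hg
      have := hq g hg
      rw [hfm]
      linarith
    have hfm' : f m = f p := by
      have := hfm f
      simp only [map_sub] at this
      linarith
    have hmax : ∀ x ∈ poly G c, (∀ g ∈ G, g (x - c) < 1) → f x < f p := by
      intro x hx hlt
      obtain ⟨y, hy, hxy⟩ := exists_lt_apply_of_isOpen hf isOpen_strict_poly hlt
      exact hxy.trans_le (hpm y fun g hg ↦ (hy g hg).le)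
    obtain ⟨g, hg, hgm⟩ : ∃ g ∈ G, g (m - c) = 1 := by
      by_contra! H
      exact (hmax m hmP fun g hg ↦ lt_of_le_of_ne (hmP g hg) (H g hg)).ne hfm'
    have hp1 : g (p - c) = 1 := by
      have := hp g hg
      have := hq g hg
      have := hfm g
      linarith
    have hq1 : g (q - c) = 1 := by
      have := hfm g
      linarith
    obtain ⟨t, rfl⟩ := exists_eq_smul_of_common_zero e (f := f) (g := g) (sub_ne_zero.2 hpq)
      (by rw [map_sub, hfpq, sub_self])
      (by rw [← sub_sub_sub_cancel_right p q c, map_sub, hp1, hq1, sub_self]) (h0 g hg)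
    have ht : 0 < t := by
      have h1 := hmax c center_mem_poly fun g _ ↦ by simp
      rw [map_sub] at hp1
      simp only [smul_apply, smul_eq_mul] at h1
      rw [← sub_pos, ← mul_sub, hp1, mul_one] at h1
      exact h1
    have hface : face G c g = {x ∈ poly G c | ∀ y ∈ poly G c, (t • g) y ≤ (t • g) x} := by
      rw [face_eq_argmax hg ⟨p, hp, hp1⟩]
      simp only [smul_apply, smul_eq_mul, mul_le_mul_iff_right₀ ht]
    exact ⟨g, ⟨hg, p, ⟨hp, hp1⟩, q, ⟨hq, hq1⟩, hpq⟩, hface⟩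
  · rintro ⟨g, ⟨hg, hn⟩, rfl⟩
    exact ⟨hn, g, h0 g hg, face_eq_argmax hg hn.nonempty⟩

/-- Empty and one-point faces have diameter 0, so redundant constraints may stay in the sum. -/
lemma perimeter_poly (e : Module.Basis (Fin 2) ℝ V) (h0 : ∀ g ∈ G, g ≠ 0) :
    perimeter (poly G c) = ∑ g ∈ G, diam (face G c g) := by
  classical
  rw [perimeter, sides_poly e h0, finsum_mem_image (face_injOn e h0)]
  have : {g | g ∈ G ∧ (face G c g).Nontrivial} =
      ((G.filter fun g ↦ (face G c g).Nontrivial : Finset _) : Set (V →L[ℝ] ℝ)) := by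
    ext; simp
  rw [this, finsum_mem_coe_finset, Finset.sum_filter_of_ne]
  intro g _ hd
  by_contra hn
  exact hd (diam_subsingleton (not_nontrivial_iff.1 hn))

variable (e : Module.Basis (Fin 2) ℝ V)

/-- A non-empty face of a bounded polygon is a segment. -/
lemma exists_face_eq_image [FiniteDimensional ℝ V] (hb : IsBounded (poly G c)) {g : V →L[ℝ] ℝ}
    (hg : g ≠ 0) (hne : (face G c g).Nonempty) :
    ∃ (p : V) (t : ℝ), 0 ≤ t ∧ face G c g = (fun s : ℝ ↦ p + s • dualToPlane e g) '' Icc 0 t ∧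
      diam (face G c g) = t * ‖dualToPlane e g‖ := by
  have hJ := dualToPlane_pos e hg
  obtain ⟨p₀, hp₀⟩ := hne
  set φ : ℝ → V := fun s ↦ p₀ + s • dualToPlane e g with hφ
  have hφc : Continuous φ := by fun_prop
  have hgφ : ∀ s, g (φ s - c) = 1 := fun s ↦ by
    have := hp₀.2
    simp only [hφ, map_sub, map_add, map_smul, apply_dualToPlane_self] at this ⊢
    simpa using this
  set I : Set ℝ := φ ⁻¹' poly G c with hI
  have hdist : ∀ s s', dist (φ s) (φ s') = |s - s'| * ‖dualToPlane e g‖ := fun s s' ↦ by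
    rw [hφ, dist_add_left, dist_eq_norm, ← sub_smul, norm_smul, Real.norm_eq_abs]
  have hIb : IsBounded I := by
    obtain ⟨R, hR⟩ := hb.subset_closedBall p₀
    refine (isBounded_iff_subset_closedBall 0).2 ⟨R / ‖dualToPlane e g‖, fun s hs ↦ ?_⟩
    have h1 : dist (φ s) p₀ ≤ R := hR hs
    have h2 : φ 0 = p₀ := by simp [hφ]
    rw [← h2, hdist] at h1
    rwa [mem_closedBall, Real.dist_eq, le_div_iff₀ hJ]
  have hIc : IsCompact I := isCompact_of_isClosed_isBounded (isClosed_poly.preimage hφc) hIb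
  have hIconv : Convex ℝ I := by
    intro s hs s' hs' a b ha hb' hab
    have : φ (a • s + b • s') = a • φ s + b • φ s' := by
      have : a • p₀ + b • p₀ = p₀ := by rw [← add_smul, hab, one_smul]
      simp only [hφ, smul_add, smul_eq_mul]
      nth_rw 1 [← this]
      module
    rw [hI, mem_preimage, this]
    exact convex_poly hs hs' ha hb' hab
  have hIne : I.Nonempty := ⟨0, by simpa [hI, hφ] using hp₀.1⟩
  have hIcc := eq_Icc_of_connected_compact ⟨hIne, hIconv.isPreconnected⟩ hIc
  set α := sInf I
  set β := sSup I
  have hαβ : α ≤ β := by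
    rw [hIcc] at hIne
    exact nonempty_Icc.1 hIne
  have hface : face G c g = (fun s : ℝ ↦ φ α + s • dualToPlane e g) '' Icc 0 (β - α) := by
    have hφs : ∀ s, φ α + s • dualToPlane e g = φ (s + α) := fun s ↦ by
      simp only [hφ]; module
    ext x
    constructor
    · rintro ⟨hx, hx1⟩
      obtain ⟨s, hs⟩ := exists_eq_smul_dualToPlane e hg (y := x - p₀)
        (by rw [← sub_sub_sub_cancel_right x p₀ c, map_sub, hx1, hp₀.2, sub_self])
      have hxs : x = φ s := by
        simp only [hφ]
        rw [← hs, add_sub_cancel]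
      have hsI : s ∈ Icc α β := by rw [← hIcc, hI, mem_preimage, ← hxs]; exact hx
      refine ⟨s - α, ⟨by linarith [hsI.1], by linarith [hsI.2]⟩, ?_⟩
      dsimp only
      rw [hφs, hxs, sub_add_cancel]
    · rintro ⟨s, hs, rfl⟩
      dsimp only
      rw [hφs]
      have : s + α ∈ I := by rw [hIcc]; exact ⟨by linarith [hs.1], by linarith [hs.2]⟩
      exact ⟨this, hgφ _⟩
  refine ⟨φ α, β - α, sub_nonneg.2 hαβ, hface, ?_⟩
  have hd : ∀ s s', dist (φ α + s • dualToPlane e g) (φ α + s' • dualToPlane e g) =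
      |s - s'| * ‖dualToPlane e g‖ := fun s s' ↦ by
    rw [dist_add_left, dist_eq_norm, ← sub_smul, norm_smul, Real.norm_eq_abs]
  apply le_antisymm
  · refine diam_le_of_forall_dist_le (mul_nonneg (sub_nonneg.2 hαβ) hJ.le) ?_
    rw [hface]
    rintro _ ⟨s, hs, rfl⟩ _ ⟨s', hs', rfl⟩
    rw [hd]
    gcongr
    rw [abs_le]
    constructor <;> linarith [hs.1, hs.2, hs'.1, hs'.2]
  · have h1 : φ α + (β - α) • dualToPlane e g ∈ face G c g := by
      rw [hface]; exact ⟨_, ⟨sub_nonneg.2 hαβ, le_rfl⟩, rfl⟩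
    have h2 : φ α + (0 : ℝ) • dualToPlane e g ∈ face G c g := by
      rw [hface]; exact ⟨_, ⟨le_rfl, sub_nonneg.2 hαβ⟩, rfl⟩
    have h3 := dist_le_diam_of_mem (hb.subset fun x hx ↦ hx.1) h1 h2
    rwa [hd, sub_zero, abs_of_nonneg (sub_nonneg.2 hαβ)] at h3

end

/-! ### Area by decomposition into triangles, and the closing relation -/

section

variable {V : Type*} [NormedAddCommGroup V] [NormedSpace ℝ V]
variable {G : Finset (V →L[ℝ] ℝ)} {c : V} (e : Module.Basis (Fin 2) ℝ V)

/-- The triangle with the vertices `0` and the two basis vectors; its area is the half of the unit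
of area that belongs to the basis. -/
def refTriangle : Set V := {x | ∃ s t : ℝ, 0 ≤ s ∧ 0 ≤ t ∧ s + t ≤ 1 ∧ x = s • e 0 + t • e 1}

lemma isBounded_refTriangle : IsBounded (refTriangle e) := by
  refine (isBounded_iff_subset_closedBall 0).2 ⟨‖e 0‖ + ‖e 1‖, ?_⟩
  rintro _ ⟨s, t, hs, ht, hst, rfl⟩
  rw [mem_closedBall_zero_iff]
  refine (norm_add_le _ _).trans ?_
  rw [norm_smul, norm_smul, Real.norm_of_nonneg hs, Real.norm_of_nonneg ht]
  gcongr
  · exact mul_le_of_le_one_left (norm_nonneg _) (by linarith)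
  · exact mul_le_of_le_one_left (norm_nonneg _) (by linarith)

/-- The part of `poly G c` that is seen from `a` in the direction of the face of `g`. -/
def sector (G : Finset (V →L[ℝ] ℝ)) (c a : V) (g : V →L[ℝ] ℝ) : Set V :=
  {x ∈ poly G c | ∀ g' ∈ G, g' (x - a) * (1 - g (a - c)) ≤ g (x - a) * (1 - g' (a - c))}

lemma isClosed_sector (a : V) (g : V →L[ℝ] ℝ) : IsClosed (sector G c a g) := by
  refine isClosed_poly.inter ?_
  have : {x | ∀ g' ∈ G, g' (x - a) * (1 - g (a - c)) ≤ g (x - a) * (1 - g' (a - c))} =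
      ⋂ g' ∈ G, {x | g' (x - a) * (1 - g (a - c)) ≤ g (x - a) * (1 - g' (a - c))} := by
    ext; simp
  change IsClosed {x | ∀ g' ∈ G, g' (x - a) * (1 - g (a - c)) ≤ g (x - a) * (1 - g' (a - c))}
  rw [this]
  exact isClosed_biInter fun g' _ ↦ isClosed_le (by fun_prop) (by fun_prop)

/-- When positive, g(x - a) / (1 - g(a - c)) is the reciprocal of the time at which the ray from a
through x leaves the half-plane of g. The largest ratio therefore marks the face that is hit first.
-/
lemma iUnion_sector (hG : G.Nonempty) {a : V} (ha : ∀ g ∈ G, g (a - c) < 1) :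
    ⋃ g ∈ G, sector G c a g = poly G c := by
  refine subset_antisymm (iUnion₂_subset fun g _ x hx ↦ hx.1) fun x hx ↦ ?_
  obtain ⟨g, hg, hmax⟩ := G.exists_max_image (fun g ↦ g (x - a) / (1 - g (a - c))) hG
  refine mem_iUnion₂.2 ⟨g, hg, hx, fun g' hg' ↦ ?_⟩
  exact (div_le_div_iff₀ (sub_pos.2 (ha g' hg')) (sub_pos.2 (ha g hg))).1 (hmax g' hg')

variable [FiniteDimensional ℝ V] [MeasurableSpace V] (μ : Measure V) [μ.IsAddHaarMeasure]

lemma measureReal_refTriangle_pos : 0 < μ.real (refTriangle e) := by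
  have h0 : Continuous (e.coord 0) := (e.coord 0).continuous_of_finiteDimensional
  have h1 : Continuous (e.coord 1) := (e.coord 1).continuous_of_finiteDimensional
  set O : Set V := {x | 0 < e.coord 0 x} ∩ {x | 0 < e.coord 1 x} ∩
    {x | e.coord 0 x + e.coord 1 x < 1} with hO
  have hOo : IsOpen O := ((isOpen_lt continuous_const h0).inter (isOpen_lt continuous_const h1)).inter
    (isOpen_lt (h0.add h1) continuous_const)
  have hOn : O.Nonempty := by
    refine ⟨(1 / 3 : ℝ) • e 0 + (1 / 3 : ℝ) • e 1, ?_⟩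
    simp [hO]
    norm_num
  have hsub : O ⊆ refTriangle e := fun x hx ↦
    ⟨_, _, hx.1.1.le, hx.1.2.le, hx.2.le, eq_coords e x⟩
  exact ENNReal.toReal_pos
    ((hOo.measure_pos μ hOn).trans_le (measure_mono hsub)).ne'
    (isBounded_refTriangle e).measure_lt_top.ne

variable [BorelSpace V]

/-- This is an affine image of the reference triangle; the determinant is τ g(p) because g(p) is the
area form of p and Jg. -/
lemma measureReal_triangle (a p : V) (g : V →L[ℝ] ℝ) (τ : ℝ) :
    μ.real {x | ∃ s t : ℝ, 0 ≤ s ∧ 0 ≤ t ∧ s + t ≤ 1 ∧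
      x = a + (s • p + t • (p + τ • dualToPlane e g))} =
      |τ * g p| * μ.real (refTriangle e) := by
  set L : V →ₗ[ℝ] V := e.constr ℝ ![p, p + τ • dualToPlane e g] with hL
  have hL0 : L (e 0) = p := by simp [hL]
  have hL1 : L (e 1) = p + τ • dualToPlane e g := by simp [hL]
  have himg : {x | ∃ s t : ℝ, 0 ≤ s ∧ 0 ≤ t ∧ s + t ≤ 1 ∧
      x = a + (s • p + t • (p + τ • dualToPlane e g))} = (fun x ↦ a + x) '' (L '' refTriangle e) := by
    ext x
    constructor
    · rintro ⟨s, t, hs, ht, hst, rfl⟩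
      exact ⟨_, ⟨_, ⟨s, t, hs, ht, hst, rfl⟩, rfl⟩, by simp [hL0, hL1]⟩
    · rintro ⟨_, ⟨_, ⟨s, t, hs, ht, hst, rfl⟩, rfl⟩, rfl⟩
      exact ⟨s, t, hs, ht, hst, by simp [hL0, hL1]⟩
  have hdet : LinearMap.det L = τ * g p := by
    rw [← LinearMap.det_toMatrix e, Matrix.det_fin_two]
    have : g p = e.repr p 0 * g (e 0) + e.repr p 1 * g (e 1) := by
      conv_lhs => rw [eq_coords e p]
      simp
    simp only [LinearMap.toMatrix_apply, hL0, hL1, this]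
    simp [dualToPlane]
    ring
  rw [himg, image_add_left, measureReal_def, measure_preimage_add,
    Measure.addHaar_image_linearMap, hdet, ENNReal.toReal_mul, ENNReal.toReal_ofReal (abs_nonneg _),
    measureReal_def]

/-- The sector is the triangle with apex a over the face: the base is measured in units of Jg, the
height by g. -/
lemma measureReal_sector (hb : IsBounded (poly G c)) {a : V} (ha : ∀ g ∈ G, g (a - c) < 1)
    {g : V →L[ℝ] ℝ} (hg : g ∈ G) (hg0 : g ≠ 0) :
    μ.real (sector G c a g) = μ.real (refTriangle e) *
      (diam (face G c g) / ‖dualToPlane e g‖ * (1 - g (a - c))) := by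
  have hag := ha g hg
  have hsplit : ∀ (g' : V →L[ℝ] ℝ) x, g' (x - c) = g' (x - a) + g' (a - c) := fun g' x ↦ by
    rw [← map_add, sub_add_sub_cancel]
  have hpos : ∀ x ∈ sector G c a g, x ≠ a → 0 < g (x - a) := by
    rintro x ⟨-, hx⟩ hxa
    by_contra! hle
    refine hxa (sub_eq_zero.1 (eq_zero_of_bounded_poly hb fun g' hg' ↦ ?_))
    by_contra! hlt
    have h1 := mul_pos hlt (sub_pos.2 hag)
    have h2 := mul_nonneg_of_nonpos_of_nonpos hle (neg_nonpos.2 (sub_pos.2 (ha g' hg')).le)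
    have := hx g' hg'
    linarith
  -- Central projection from a onto the face.
  have hproj : ∀ x ∈ sector G c a g, x ≠ a →
      a + ((1 - g (a - c)) / g (x - a)) • (x - a) ∈ face G c g := by
    intro x hx hxa
    have hp := hpos x hx hxa
    refine ⟨fun g' hg' ↦ ?_, ?_⟩
    · rw [hsplit, add_sub_cancel_left, map_smul, smul_eq_mul]
      have := hx.2 g' hg'
      have h3 : (1 - g (a - c)) / g (x - a) * g' (x - a) ≤ 1 - g' (a - c) := by
        rw [div_mul_eq_mul_div, div_le_iff₀ hp]
        linarith
      linarith
    · rw [hsplit, add_sub_cancel_left, map_smul, smul_eq_mul, div_mul_cancel₀ _ hp.ne']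
      ring
  rcases (face G c g).eq_empty_or_nonempty with he | hne
  · have hsub : sector G c a g ⊆ {a} := fun x hx ↦ by
      by_contra hxa
      have := hproj x hx hxa
      rw [he] at this
      exact this
    have : Nontrivial V := ⟨e 0, 0, e.ne_zero 0⟩
    have h0 : μ (sector G c a g) = 0 := measure_mono_null hsub (measure_singleton a)
    rw [measureReal_def, h0, he, diam_empty]
    simp
  · obtain ⟨p, t, ht, himg, hdiam⟩ := exists_face_eq_image e hb hg0 hne
    have hsec : sector G c a g = {x | ∃ s t' : ℝ, 0 ≤ s ∧ 0 ≤ t' ∧ s + t' ≤ 1 ∧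
        x = a + (s • (p - a) + t' • ((p - a) + t • dualToPlane e g))} := by
      have hp : p ∈ face G c g := by
        rw [himg]; exact ⟨0, ⟨le_rfl, ht⟩, by simp⟩
      have hq : p + t • dualToPlane e g ∈ face G c g := by
        rw [himg]; exact ⟨t, ⟨ht, le_rfl⟩, rfl⟩
      ext x
      constructor
      · intro hx
        rcases eq_or_ne x a with rfl | hxa
        · exact ⟨0, 0, le_rfl, le_rfl, by norm_num, by simp⟩
        have hy := hproj x hx hxa
        have hgx := hpos x hx hxa
        rw [himg] at hy
        obtain ⟨s, ⟨hs0, hst⟩, hs⟩ := hy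
        set r := g (x - a) / (1 - g (a - c)) with hr
        have hr0 : 0 < r := div_pos hgx (sub_pos.2 hag)
        have hr1 : r ≤ 1 := by
          rw [hr, div_le_one (sub_pos.2 hag)]
          have := hx.1 g hg
          rw [hsplit] at this
          linarith
        have hinv : (1 - g (a - c)) / g (x - a) = r⁻¹ := by rw [hr, inv_div]
        rw [hinv] at hs
        have hxs : x = a + r • (p - a + s • dualToPlane e g) := by
          have : p - a + s • dualToPlane e g = r⁻¹ • (x - a) := by
            rw [sub_add_eq_add_sub, sub_eq_iff_eq_add']
            exact hs
          rw [this, smul_smul, mul_inv_cancel₀ hr0.ne', one_smul, add_sub_cancel]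
        -- A face that is a single point is separated off, as the coordinates below divide by t.
        rcases ht.eq_or_lt with rfl | htpos
        · have : s = 0 := le_antisymm hst hs0
          refine ⟨r, 0, hr0.le, le_rfl, by linarith, ?_⟩
          rw [hxs, this]
          simp
        · refine ⟨r * (1 - s / t), r * (s / t), ?_, by positivity, by linarith, ?_⟩
          · exact mul_nonneg hr0.le (sub_nonneg.2 ((div_le_one htpos).2 hst))
          · conv_lhs => rw [hxs]
            have : s = s / t * t := (div_mul_cancel₀ _ htpos.ne').symm
            conv_lhs => rw [this]
            module
      · rintro ⟨s, t', hs, ht', hst, rfl⟩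
        set q := p + t • dualToPlane e g with hqdef
        have hqa : p - a + t • dualToPlane e g = q - a := by rw [hqdef]; abel
        rw [hqa]
        have hval : ∀ g' : V →L[ℝ] ℝ, g' (a + (s • (p - a) + t' • (q - a)) - a) =
            s * g' (p - a) + t' * g' (q - a) := fun g' ↦ by
          rw [add_sub_cancel_left, map_add, map_smul, map_smul, smul_eq_mul, smul_eq_mul]
        have hle : ∀ g' ∈ G, s * g' (p - a) + t' * g' (q - a) ≤ (s + t') * (1 - g' (a - c)) := by
          intro g' hg'
          have h1 := hp.1 g' hg'
          have h2 := hq.1 g' hg'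
          rw [hsplit] at h1 h2
          have h3 : g' (p - a) ≤ 1 - g' (a - c) := by linarith
          have h4 : g' (q - a) ≤ 1 - g' (a - c) := by linarith
          rw [add_mul]
          gcongr
        refine ⟨fun g' hg' ↦ ?_, fun g' hg' ↦ ?_⟩
        · rw [hsplit, hval]
          have h1 := hle g' hg'
          have h2 := mul_le_of_le_one_left (sub_pos.2 (ha g' hg')).le hst
          linarith
        · have h1 : g (p - a) = 1 - g (a - c) := by have := hp.2; rw [hsplit] at this; linarith
          have h2 : g (q - a) = 1 - g (a - c) := by have := hq.2; rw [hsplit] at this; linarith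
          rw [hval, hval, h1, h2]
          have := mul_le_mul_of_nonneg_right (hle g' hg') (sub_pos.2 hag).le
          linarith
    have h1 : g (p - a) = 1 - g (a - c) := by
      have hp : p ∈ face G c g := by
        rw [himg]; exact ⟨0, ⟨le_rfl, ht⟩, by simp⟩
      have := hp.2
      rw [hsplit] at this
      linarith
    rw [hsec, measureReal_triangle, hdiam, h1,
      mul_div_cancel_right₀ _ (dualToPlane_pos e hg0).ne',
      abs_of_nonneg (mul_nonneg ht (sub_pos.2 hag).le), mul_comm]

lemma measure_hyperplane {φ : V →L[ℝ] ℝ} (hφ : φ ≠ 0) (a : V) :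
    μ {x | φ (x - a) = 0} = 0 := by
  have h : {x | φ (x - a) = 0} =
      (fun x ↦ x + -a) ⁻¹' (LinearMap.ker (φ : V →ₗ[ℝ] ℝ) : Set V) := by
    ext x; simp [sub_eq_add_neg]
  rw [h, measure_preimage_add_right]
  refine Measure.addHaar_submodule μ _ fun h ↦ hφ ?_
  ext x
  have : x ∈ LinearMap.ker (φ : V →ₗ[ℝ] ℝ) := by rw [h]; trivial
  simpa using this

/-- The area of a polygon as the sum of the areas of the triangles with apex `a` over its sides. -/
lemma measureReal_poly (h0 : ∀ g ∈ G, g ≠ 0) (hb : IsBounded (poly G c)) {a : V}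
    (ha : ∀ g ∈ G, g (a - c) < 1) :
    μ.real (poly G c) = μ.real (refTriangle e) *
      ∑ g ∈ G, diam (face G c g) / ‖dualToPlane e g‖ * (1 - g (a - c)) := by
  have hG : G.Nonempty := by
    rw [Finset.nonempty_iff_ne_empty]
    rintro rfl
    exact e.ne_zero 0 (eq_zero_of_bounded_poly hb (by simp))
  rw [← iUnion_sector hG ha, measureReal_biUnion_finset₀ ?_ ?_
    fun g _ ↦ ((hb.subset fun x hx ↦ hx.1).measure_lt_top).ne, Finset.mul_sum]
  · exact Finset.sum_congr rfl fun g hg ↦ measureReal_sector e μ hb ha hg (h0 g hg)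
  · intro g hg g' hg' hne
    -- On the overlap of two sectors both defining inequalities are equalities, which confines it to
    -- a line through a.
    refine measure_mono_null (t := {x | ((1 - g (a - c)) • g' - (1 - g' (a - c)) • g) (x - a) = 0})
      ?_ (measure_hyperplane μ ?_ a)
    · rintro x ⟨⟨-, h1⟩, -, h2⟩
      have h3 := h1 g' hg'
      have h4 := h2 g hg
      simp only [mem_ofPred_eq, sub_apply, smul_apply, smul_eq_mul]
      linarith
    · intro h
      have h1 := DFunLike.congr_fun h (a - c)
      simp only [sub_apply, smul_apply, smul_eq_mul, zero_apply] at h1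
      have h2 : g (a - c) = g' (a - c) := by linarith
      refine hne (ContinuousLinearMap.ext fun x ↦ ?_)
      have h3 := DFunLike.congr_fun h x
      simp only [sub_apply, smul_apply, smul_eq_mul, zero_apply, h2] at h3
      exact mul_left_cancel₀ (sub_pos.2 (ha g' hg')).ne' (by linarith)
  · exact fun g _ ↦ (isClosed_sector a g).measurableSet.nullMeasurableSet

lemma measureReal_poly_center (h0 : ∀ g ∈ G, g ≠ 0) (hb : IsBounded (poly G c)) :
    μ.real (poly G c) = μ.real (refTriangle e) *
      ∑ g ∈ G, diam (face G c g) / ‖dualToPlane e g‖ := by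
  rw [measureReal_poly e μ h0 hb (a := c) (by simp)]
  simp

/-- The sum of the sides of a polygon, as vectors, vanishes. -/
lemma sum_sides_eq_zero (μ : Measure V) [μ.IsAddHaarMeasure] (h0 : ∀ g ∈ G, g ≠ 0)
    (hb : IsBounded (poly G c)) :
    ∑ g ∈ G, (diam (face G c g) / ‖dualToPlane e g‖) • g = 0 := by
  ext v
  -- So small that c + δv is still strictly inside; comparing the area formulas for the apexes c and
  -- c + δv isolates the value of the sum at v.
  set δ : ℝ := (1 + ∑ g ∈ G, |g v|)⁻¹ with hδ
  have hS : 0 ≤ ∑ g ∈ G, |g v| := Finset.sum_nonneg fun _ _ ↦ abs_nonneg _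
  have hδ0 : 0 < δ := by positivity
  have h1 := measureReal_poly e μ h0 hb (a := c + δ • v) fun g hg ↦ by
    rw [add_sub_cancel_left, map_smul, smul_eq_mul, hδ, inv_mul_lt_one₀ (by positivity)]
    have := Finset.single_le_sum (f := fun g : V →L[ℝ] ℝ ↦ |g v|) (fun _ _ ↦ abs_nonneg _) hg
    have := le_abs_self (g v)
    linarith
  rw [measureReal_poly_center e μ h0 hb] at h1
  have h2 := mul_left_cancel₀ (measureReal_refTriangle_pos e μ).ne' h1
  simp only [add_sub_cancel_left, map_smul, smul_eq_mul, mul_sub, mul_one,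
    Finset.sum_sub_distrib] at h2
  have h3 : ∑ g ∈ G, diam (face G c g) / ‖dualToPlane e g‖ * (δ * g v) =
      δ * ∑ g ∈ G, diam (face G c g) / ‖dualToPlane e g‖ * g v := by
    rw [Finset.mul_sum]
    exact Finset.sum_congr rfl fun _ _ ↦ by ring
  rw [h3] at h2
  have h4 : δ * ∑ g ∈ G, diam (face G c g) / ‖dualToPlane e g‖ * g v = 0 := by linarith
  simpa using (mul_eq_zero.1 h4).resolve_left hδ0.ne'

end

/-! ### Circumscribed polygons and triangles -/

section

variable {V : Type*} [NormedAddCommGroup V] [NormedSpace ℝ V]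
variable {G : Finset (V →L[ℝ] ℝ)} {c : V} {ρ : ℝ}

lemma mul_norm_le_one_of_closedBall_subset (hρ : 0 < ρ) {g : V →L[ℝ] ℝ}
    (h : ∀ x ∈ closedBall c ρ, g (x - c) ≤ 1) : ρ * ‖g‖ ≤ 1 := by
  rw [mul_comm, ← le_div_iff₀ hρ]
  have key : ∀ x, g x ≤ 1 / ρ * ‖x‖ := by
    intro x
    rcases eq_or_ne x 0 with rfl | hx
    · simp
    have hx' := norm_pos_iff.2 hx
    have := h (c + (ρ / ‖x‖) • x) (by
      rw [mem_closedBall, dist_self_add_left, norm_smul, Real.norm_of_nonneg (by positivity),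
        div_mul_cancel₀ _ hx'.ne'])
    rw [add_sub_cancel_left, map_smul, smul_eq_mul, div_mul_eq_mul_div, div_le_one hx'] at this
    rw [div_mul_eq_mul_div, le_div_iff₀ hρ]
    linarith
  refine g.opNorm_le_bound (by positivity) fun x ↦ ?_
  rw [Real.norm_eq_abs, abs_le]
  have := key (-x)
  rw [map_neg, norm_neg] at this
  exact ⟨by linarith, key x⟩

lemma one_le_mul_norm_of_mem_closedBall {g : V →L[ℝ] ℝ} {x : V} (hx : x ∈ closedBall c ρ)
    (hg : g (x - c) = 1) : 1 ≤ ρ * ‖g‖ := by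
  have h1 := (le_abs_self _).trans (g.le_opNorm (x - c))
  rw [mem_closedBall, dist_eq_norm] at hx
  rw [hg] at h1
  have := mul_le_mul_of_nonneg_left hx (norm_nonneg g)
  linarith

lemma closedBall_subset_poly (hG : ∀ g ∈ G, ρ * ‖g‖ ≤ 1) : closedBall c ρ ⊆ poly G c := by
  intro x hx g hg
  have h1 := (le_abs_self _).trans (g.le_opNorm (x - c))
  rw [mem_closedBall, dist_eq_norm] at hx
  have := mul_le_mul_of_nonneg_left hx (norm_nonneg g)
  have := hG g hg
  linarith

/-- A half-plane that contains a disc with centre `c` in normalized form. -/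
lemma exists_normalized_halfPlane (hρ : 0 < ρ) {f : V →L[ℝ] ℝ} {b : ℝ} (hf : f ≠ 0)
    (h : closedBall c ρ ⊆ {x | f x ≤ b}) :
    ∃ g : V →L[ℝ] ℝ, g ≠ 0 ∧ (∀ x, g (x - c) ≤ 1 ↔ f x ≤ b) ∧ ∀ x, g (x - c) = 1 ↔ f x = b := by
  obtain ⟨y, hy, hlt⟩ := exists_lt_apply_of_isOpen hf isOpen_ball (mem_ball_self (x := c) hρ)
  have hb : 0 < b - f c := by
    have : f y ≤ b := h (ball_subset_closedBall hy)
    linarith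
  refine ⟨(b - f c)⁻¹ • f, smul_ne_zero (inv_ne_zero hb.ne') hf, fun x ↦ ?_, fun x ↦ ?_⟩
  · rw [smul_apply, smul_eq_mul, inv_mul_le_one₀ hb, map_sub, sub_le_sub_iff_right]
  · rw [smul_apply, smul_eq_mul, inv_mul_eq_one₀ hb.ne', map_sub, sub_left_inj, eq_comm]

lemma exists_poly_eq_sInter (Q : (V →L[ℝ] ℝ) → Prop) {𝓗 : Set (Set V)} (hfin : 𝓗.Finite)
    (h : ∀ H ∈ 𝓗, ∃ g : V →L[ℝ] ℝ, Q g ∧ H = {x | g (x - c) ≤ 1}) :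
    ∃ G : Finset (V →L[ℝ] ℝ), ⋂₀ 𝓗 = poly G c ∧ G.card = 𝓗.ncard ∧ ∀ g ∈ G, Q g := by
  classical
  choose! φ hQ hφ using h
  refine ⟨hfin.toFinset.image φ, ?_, ?_, ?_⟩
  · ext x
    simp only [mem_sInter, poly, mem_ofPred_eq, Finset.forall_mem_image, Finite.mem_toFinset]
    refine forall₂_congr fun H hH ↦ ?_
    conv_lhs => rw [hφ H hH]
    rfl
  · rw [Finset.card_image_of_injOn, ncard_eq_toFinset_card _ hfin]
    intro H hH H' hH' heq
    rw [hφ H (hfin.mem_toFinset.1 hH), hφ H' (hfin.mem_toFinset.1 hH'), heq]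
  · simpa using hQ

/-- A circumscribed polygon as a polyhedron whose proper sides belong to functionals of norm
`1 / ρ`. -/
lemma exists_poly_of_isCircumscribed {P : Set V} (hρ : 0 < ρ) (hP : IsConvexPolygon P)
    (hc : IsCircumscribed P c ρ) (e : Module.Basis (Fin 2) ℝ V) :
    ∃ G : Finset (V →L[ℝ] ℝ), P = poly G c ∧ (∀ g ∈ G, g ≠ 0) ∧
      ∀ g ∈ G, diam (face G c g) ≠ 0 → ρ * ‖g‖ = 1 := by
  obtain ⟨-, -, 𝓗, hfin, hH, rfl⟩ := hP
  obtain ⟨G, hG, -, hG0⟩ := exists_poly_eq_sInter (c := c) (fun g ↦ g ≠ 0) hfin fun H hHm ↦ by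
    obtain ⟨f, b, hf, rfl⟩ := hH H hHm
    obtain ⟨g, hg, hg1, -⟩ :=
      exists_normalized_halfPlane hρ hf (hc.1.trans (sInter_subset_of_mem hHm))
    exact ⟨g, hg, by ext x; exact (hg1 x).symm⟩
  refine ⟨G, hG, hG0, fun g hg hd ↦ ?_⟩
  rw [hG] at hc
  refine le_antisymm (mul_norm_le_one_of_closedBall_subset hρ fun x hx ↦ hc.1 hx g hg) ?_
  have hn : (face G c g).Nontrivial := by
    by_contra hn
    exact hd (diam_subsingleton (not_nontrivial_iff.1 hn))
  obtain ⟨x, hx, hxb⟩ := hc.2 (face G c g) (by rw [sides_poly e hG0]; exact ⟨g, ⟨hg, hn⟩, rfl⟩)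
  exact one_le_mul_norm_of_mem_closedBall hxb hx.2

lemma perimeter_eq_of_norm_dualToPlane [FiniteDimensional ℝ V] [MeasurableSpace V] [BorelSpace V]
    (μ : Measure V) [μ.IsAddHaarMeasure] (e : Module.Basis (Fin 2) ℝ V) {k : ℝ} (hk : 0 < k)
    (h : ∀ g : V →L[ℝ] ℝ, ‖dualToPlane e g‖ = k * ‖g‖) {P : Set V} (hρ : 0 < ρ)
    (hP : IsConvexPolygon P) (hc : IsCircumscribed P c ρ) :
    ρ * perimeter P = k / μ.real (refTriangle e) * μ.real P := by
  obtain ⟨G, rfl, h0, hG⟩ := exists_poly_of_isCircumscribed hρ hP hc e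
  rw [perimeter_poly e h0, measureReal_poly_center e μ h0 hP.1, ← mul_assoc,
    div_mul_cancel₀ _ (measureReal_refTriangle_pos e μ).ne', Finset.mul_sum, Finset.mul_sum]
  refine Finset.sum_congr rfl fun g hg ↦ ?_
  by_cases hd : diam (face G c g) = 0
  · simp [hd]
  · have h1 := hG g hg hd
    have h2 : ‖g‖ = 1 / ρ := by rw [eq_div_iff hρ.ne', mul_comm, h1]
    rw [h, h2]
    field_simp

lemma IsTriangle.isConvexPolygon (hV : Module.finrank ℝ V = 2) {P : Set V} (hP : IsTriangle P) :
    IsConvexPolygon P := by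
  have : FiniteDimensional ℝ V := Module.finite_of_finrank_pos (by omega)
  obtain ⟨p, hp, rfl⟩ := hP
  let b : AffineBasis (Fin 3) ℝ V := ⟨p, hp, by
    rw [hp.affineSpan_eq_top_iff_card_eq_finrank_add_one, hV]; rfl⟩
  have hb : ⇑b = p := rfl
  refine ⟨isBounded_convexHull.2 (finite_range p).isBounded, ?_,
    range fun i ↦ {x | 0 ≤ b.coord i x}, finite_range _, ?_, ?_⟩
  · rw [← hb]
    exact ⟨_, b.centroid_mem_interior_convexHull⟩
  · rintro _ ⟨i, rfl⟩
    have hlin : ∀ x, b.coord i x = (b.coord i).linear x + b.coord i 0 := fun x ↦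
      congrFun (b.coord i).decomp x
    refine ⟨-LinearMap.toContinuousLinearMap (b.coord i).linear, b.coord i 0, fun h ↦ ?_, ?_⟩
    · have hz : ∀ x, (b.coord i).linear x = 0 := fun x ↦ by
        simpa using DFunLike.congr_fun h x
      obtain ⟨j, hj⟩ := exists_ne i
      have h1 := b.coord_apply_eq i
      have h2 := b.coord_apply_ne hj.symm
      rw [hlin, hz] at h1 h2
      linarith
    · ext x
      rw [mem_ofPred_eq, mem_ofPred_eq, hlin, neg_apply, LinearMap.coe_toContinuousLinearMap']
      constructor <;> intro h <;> linarith
  · rw [← hb, b.convexHull_eq_nonneg_coord]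
    ext x
    simp

/-- Normal functionals of a circumscribed `n`-gon. -/
lemma IsCircumscribedNGon.exists_poly {n : ℕ} {P : Set V} (hρ : 0 < ρ)
    (hP : IsCircumscribedNGon n P c ρ) :
    ∃ G : Finset (V →L[ℝ] ℝ), P = poly G c ∧ G.card = n ∧ (∀ g ∈ G, g ≠ 0) ∧
      (∀ g ∈ G, ρ * ‖g‖ ≤ 1) ∧ ∀ g ∈ G, ∃ x ∈ closedBall c ρ, g (x - c) = 1 := by
  obtain ⟨-, 𝓗, hfin, hcard, hH, rfl⟩ := hP
  obtain ⟨G, hG, hGc, hG1⟩ := exists_poly_eq_sInter (c := c)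
    (fun g ↦ g ≠ 0 ∧ ρ * ‖g‖ ≤ 1 ∧ ∃ x ∈ closedBall c ρ, g (x - c) = 1) hfin fun H hHm ↦ by
      obtain ⟨f, b, hf, rfl, hsub, x, hx, hfx⟩ := hH H hHm
      obtain ⟨g, hg, hg1, hg2⟩ := exists_normalized_halfPlane hρ hf hsub
      exact ⟨g, ⟨hg, mul_norm_le_one_of_closedBall_subset hρ fun y hy ↦ (hg1 y).2 (hsub hy),
        x, hx, (hg2 x).2 hfx⟩, by ext y; exact (hg1 y).symm⟩
  exact ⟨G, hG, hGc.trans hcard, fun g hg ↦ (hG1 g hg).1, fun g hg ↦ (hG1 g hg).2.1,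
    fun g hg ↦ (hG1 g hg).2.2⟩

lemma IsCircumscribedNGon.isCircumscribed {n : ℕ} {P : Set V} (hρ : 0 < ρ)
    (hP : IsCircumscribedNGon n P c ρ) (e : Module.Basis (Fin 2) ℝ V) : IsCircumscribed P c ρ := by
  obtain ⟨G, rfl, -, h0, hle, htouch⟩ := hP.exists_poly hρ
  have hsub := closedBall_subset_poly (c := c) hle
  refine ⟨hsub, fun S hS ↦ ?_⟩
  rw [sides_poly e h0] at hS
  obtain ⟨g, ⟨hg, -⟩, rfl⟩ := hS
  obtain ⟨x, hx, hgx⟩ := htouch g hg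
  exact ⟨x, ⟨hsub hx, hgx⟩, hx⟩

/-- Boundedness makes the three normals pairwise independent, hence all coefficients of the relation
positive. The barycentric coordinates of x are then τ_i (1 - g_i(x - c)) / S, where S is the sum of
the coefficients. -/
lemma isTriangle_poly_of_card_eq_three [FiniteDimensional ℝ V] (e : Module.Basis (Fin 2) ℝ V)
    (h0 : ∀ g ∈ G, g ≠ 0) (hb : IsBounded (poly G c)) (hcard : G.card = 3)
    {τ : (V →L[ℝ] ℝ) → ℝ} (hτ : ∀ g ∈ G, 0 ≤ τ g) (hτ0 : ∃ g ∈ G, τ g ≠ 0)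
    (hsum : ∑ g ∈ G, τ g • g = 0) : IsTriangle (poly G c) := by
  have ex : ∀ i j : Fin 3, i ≠ j → ∃ k, k ≠ i ∧ k ≠ j ∧ ∀ m, m = i ∨ m = j ∨ m = k := by decide
  let E := G.equivFinOfCardEq hcard
  let g : Fin 3 → (V →L[ℝ] ℝ) := fun i ↦ (E.symm i : V →L[ℝ] ℝ)
  have hgG : ∀ i, g i ∈ G := fun i ↦ (E.symm i).2
  have hGg : ∀ f ∈ G, ∃ i, g i = f := fun f hf ↦ ⟨E ⟨f, hf⟩, by simp [g]⟩
  have hall : ∀ q : (V →L[ℝ] ℝ) → Prop, (∀ i, q (g i)) → ∀ f ∈ G, q f := fun q hq f hf ↦ by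
    obtain ⟨i, rfl⟩ := hGg f hf
    exact hq i
  have hsum' : ∑ i, τ (g i) • g i = 0 := by
    rw [← hsum, ← Finset.sum_coe_sort G, ← E.symm.sum_comp]
  have hsumx : ∀ x, ∑ i, τ (g i) * g i x = 0 := fun x ↦ by
    simpa using DFunLike.congr_fun hsum' x
  have hind : ∀ i j, i ≠ j → g i (dualToPlane e (g j)) ≠ 0 := by
    intro i j hij hz
    obtain ⟨k, -, -, hk⟩ := ex i j hij
    have hne := dualToPlane_ne_zero e (h0 _ (hgG j))
    -- If two normals were proportional, J of one of them or its negative, according to the sign of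
    -- the third normal on it, would be an unbounded direction.
    rcases le_total (g k (dualToPlane e (g j))) 0 with hle | hle
    · refine hne (eq_zero_of_bounded_poly hb (hall _ fun m ↦ ?_))
      rcases hk m with rfl | rfl | rfl
      exacts [hz.le, (apply_dualToPlane_self e _).le, hle]
    · refine neg_ne_zero.2 hne (eq_zero_of_bounded_poly hb (hall _ fun m ↦ ?_))
      rw [map_neg, neg_nonpos]
      rcases hk m with rfl | rfl | rfl
      exacts [hz.ge, (apply_dualToPlane_self e _).ge, hle]
  have hpos : ∀ i, 0 < τ (g i) := by
    intro i
    refine lt_of_le_of_ne (hτ _ (hgG i)) fun hi ↦ ?_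
    obtain ⟨f, hf, hne⟩ := hτ0
    obtain ⟨k, rfl⟩ := hGg f hf
    have hik : i ≠ k := by rintro rfl; exact hne hi.symm
    obtain ⟨j, hji, hjk, hm⟩ := ex i k hik
    -- Evaluating at J(g j) removes the term of j; if the coefficient of i vanished, only the
    -- nonzero term of k would remain.
    have h1 := hsumx (dualToPlane e (g j))
    rw [Finset.sum_eq_single k] at h1
    · exact (mul_ne_zero hne (hind k j hjk.symm)) h1
    · intro m _ hmk
      rcases hm m with rfl | rfl | rfl
      · rw [← hi, zero_mul]
      · exact absurd rfl hmk
      · rw [apply_dualToPlane_self, mul_zero]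
    · simp
  set S := ∑ i, τ (g i) with hS
  have hSpos : 0 < S := Finset.sum_pos (fun i _ ↦ hpos i) Finset.univ_nonempty
  have hvert : ∀ i, ∃ p, ∀ j, j ≠ i → g j (p - c) = 1 := by
    intro i
    obtain ⟨j, hj⟩ := exists_ne i
    obtain ⟨k, hki, hkj, hm⟩ := ex i j hj.symm
    -- The vertex opposite to side i: the solution of the two remaining equations by Cramer's rule.
    refine ⟨c + (g j (dualToPlane e (g k)))⁻¹ • (dualToPlane e (g k) - dualToPlane e (g j)),
      fun m hmi ↦ ?_⟩
    have hne := hind j k hkj.symm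
    rw [add_sub_cancel_left, map_smul, map_sub, smul_eq_mul]
    rcases hm m with rfl | rfl | rfl
    · exact absurd rfl hmi
    · rw [apply_dualToPlane_self, sub_zero, inv_mul_cancel₀ hne]
    · rw [apply_dualToPlane_self, zero_sub, ← apply_dualToPlane_swap, inv_mul_cancel₀ hne]
  choose p hp using hvert
  have hpi : ∀ i j, g j (p i - c) = 1 - if i = j then S / τ (g j) else 0 := by
    intro i j
    split_ifs with hij
    · subst hij
      have h1 := hsumx (p i - c)
      have h2 : ∑ m, τ (g m) * (1 - g m (p i - c)) = τ (g i) * (1 - g i (p i - c)) :=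
        Finset.sum_eq_single i (fun m _ hm ↦ by rw [hp i m hm]; ring) (by simp)
      simp only [mul_sub, mul_one, Finset.sum_sub_distrib, h1] at h2
      have := (hpos i).ne'
      field_simp
      linarith
    · rw [hp i j (Ne.symm hij), sub_zero]
  have hcomb : ∀ (s : Finset (Fin 3)) (w : Fin 3 → ℝ), ∀ j ∈ s,
      ∑ i ∈ s, w i * g j (p i - c) = ∑ i ∈ s, w i - w j * (S / τ (g j)) := by
    intro s w j hj
    simp only [hpi, mul_sub, mul_one, Finset.sum_sub_distrib, mul_ite, mul_zero,
      Finset.sum_ite_eq', hj, if_true]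
  refine ⟨p, ?_, ?_⟩
  · rw [affineIndependent_iff]
    intro s w hw hwp j hj
    have h1 : g j (∑ i ∈ s, w i • (p i - c)) = 0 := by
      simp only [smul_sub, Finset.sum_sub_distrib, hwp, ← Finset.sum_smul, hw, zero_smul, sub_zero,
        map_zero]
    simp only [map_sum, map_smul, smul_eq_mul] at h1
    rw [hcomb s w j hj, hw, zero_sub, neg_eq_zero] at h1
    exact (mul_eq_zero.1 h1).resolve_right (div_pos hSpos (hpos j)).ne'
  · refine subset_antisymm (fun x hx ↦ ?_) (convexHull_min ?_ convex_poly)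
    · set w : Fin 3 → ℝ := fun i ↦ τ (g i) * (1 - g i (x - c)) / S with hw
      have hw0 : ∀ i, 0 ≤ w i := fun i ↦
        div_nonneg (mul_nonneg (hpos i).le (sub_nonneg.2 (hx _ (hgG i)))) hSpos.le
      have hw1 : ∑ i, w i = 1 := by
        simp only [hw, ← Finset.sum_div, mul_sub, mul_one, Finset.sum_sub_distrib, hsumx, ← hS,
          sub_zero]
        exact div_self hSpos.ne'
      have hxw : x = ∑ i, w i • p i := by
        refine sub_eq_zero.1 (eq_zero_of_bounded_poly hb (hall _ fun j ↦ ?_))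
        have h1 : x - ∑ i, w i • p i = (x - c) - ∑ i, w i • (p i - c) := by
          simp only [smul_sub, Finset.sum_sub_distrib, ← Finset.sum_smul, hw1, one_smul]
          abel
        rw [h1, map_sub, map_sum]
        simp only [map_smul, smul_eq_mul]
        rw [hcomb _ _ j (Finset.mem_univ j), hw1, hw]
        have := (hpos j).ne'
        field_simp
        linarith
      rw [hxw]
      exact (convex_convexHull ℝ _).sum_mem (fun i _ ↦ hw0 i) hw1
        fun i _ ↦ subset_convexHull ℝ _ (mem_range_self i)
    · rintro _ ⟨i, rfl⟩
      refine hall _ fun j ↦ ?_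
      rw [hpi]
      have : 0 ≤ if i = j then S / τ (g j) else 0 := by
        split_ifs
        exacts [(div_pos hSpos (hpos j)).le, le_rfl]
      linarith

/-- The closing relation of the sides supplies the coefficients; they are not all zero because the
area is positive. -/
lemma IsCircumscribedNGon.isTriangle [FiniteDimensional ℝ V] [MeasurableSpace V] [BorelSpace V]
    (μ : Measure V) [μ.IsAddHaarMeasure] (e : Module.Basis (Fin 2) ℝ V) {P : Set V} (hρ : 0 < ρ)
    (hP : IsCircumscribedNGon 3 P c ρ) : IsTriangle P := by
  have hb := hP.1
  obtain ⟨G, rfl, hcard, h0, hle, -⟩ := hP.exists_poly hρ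
  refine isTriangle_poly_of_card_eq_three e h0 hb hcard
    (fun g _ ↦ div_nonneg diam_nonneg (norm_nonneg _)) ?_ (sum_sides_eq_zero e μ h0 hb)
  by_contra! H
  have h1 := measureReal_poly_center e μ h0 hb
  rw [Finset.sum_eq_zero H, mul_zero] at h1
  have h2 : 0 < μ.real (poly G c) := ENNReal.toReal_pos
    ((measure_closedBall_pos μ c hρ).trans_le (measure_mono (closedBall_subset_poly hle))).ne'
    hb.measure_lt_top.ne
  linarith

end

/-! ### From the formula for n-gons to proportional norms -/

section

variable {V : Type*} [NormedAddCommGroup V] [NormedSpace ℝ V]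
variable {G : Finset (V →L[ℝ] ℝ)}

lemma exists_mem_closedBall_apply_eq_norm [FiniteDimensional ℝ V] (g : V →L[ℝ] ℝ) :
    ∃ x ∈ closedBall (0 : V) 1, g x = ‖g‖ := by
  obtain ⟨x, hx, hmax⟩ := (isCompact_closedBall (0 : V) 1).exists_isMaxOn
    ⟨0, mem_closedBall_self zero_le_one⟩ g.continuous.continuousOn
  refine ⟨x, hx, le_antisymm ?_ ?_⟩
  · rw [mem_closedBall_zero_iff] at hx
    exact (le_abs_self _).trans ((g.le_opNorm x).trans (mul_le_of_le_one_right (norm_nonneg _) hx))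
  · have h0 : 0 ≤ g x := by
      have := hmax (mem_closedBall_self zero_le_one : (0 : V) ∈ closedBall (0 : V) 1)
      simpa using this
    rcases h0.eq_or_lt with h0 | h0
    · have hz : g = 0 := by
        by_contra hg
        obtain ⟨y, hy, hlt⟩ := exists_lt_apply_of_isOpen hg isOpen_ball
          (mem_ball_self (x := (0 : V)) one_pos)
        have h1 : g y ≤ g x := hmax (ball_subset_closedBall hy)
        rw [map_zero] at hlt
        linarith
      simp [hz]
    · have h1 := mul_norm_le_one_of_closedBall_subset (c := (0 : V)) (ρ := 1) one_pos
        (g := (g x)⁻¹ • g) fun y hy ↦ by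
          have h1 : g y ≤ g x := hmax hy
          rwa [sub_zero, smul_apply, smul_eq_mul, inv_mul_le_one₀ h0]
      rwa [one_mul, norm_smul, norm_inv, Real.norm_of_nonneg h0.le, inv_mul_le_one₀ h0] at h1

/-- If the values at x differed, rescaling x or -x would put the level 1 between them. This ensures
that different functionals count as different sides. -/
lemma eq_of_halfPlane_eq {g g' : V →L[ℝ] ℝ} (h : {x | g x ≤ 1} = {x | g' x ≤ 1}) : g = g' := by
  have key : ∀ {g g' : V →L[ℝ] ℝ}, {x | g x ≤ 1} = {x | g' x ≤ 1} → ∀ x, g' x ≤ g x := by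
    intro g g' h x
    by_contra! hlt
    have hscale : ∀ t : ℝ, 0 < t → (t * g x ≤ 1 ↔ t * g' x ≤ 1) := fun t _ ↦ by
      have : t • x ∈ {x | g x ≤ 1} ↔ t • x ∈ {x | g' x ≤ 1} := by rw [h]
      simpa using this
    have hneg : ∀ t : ℝ, 0 < t → (t * -g x ≤ 1 ↔ t * -g' x ≤ 1) := fun t _ ↦ by
      have : t • -x ∈ {x | g x ≤ 1} ↔ t • -x ∈ {x | g' x ≤ 1} := by rw [h]
      simpa using this
    rcases lt_or_ge 0 (g' x) with hp | hn
    · obtain ⟨m, hm1, hm2⟩ := exists_between (max_lt hlt hp)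
      have hm0 : 0 < m := (le_max_right _ _).trans_lt hm1
      have h1 := (hscale m⁻¹ (inv_pos.2 hm0)).1
        (by rw [inv_mul_le_one₀ hm0]; exact (le_max_left _ _).trans hm1.le)
      rw [inv_mul_le_one₀ hm0] at h1
      linarith
    · have hx : 0 < -g x := by linarith
      obtain ⟨m, hm1, hm2⟩ := exists_between (max_lt (show -g' x < -g x by linarith) hx)
      have hm0 : 0 < m := (le_max_right _ _).trans_lt hm1
      have h1 := (hneg m⁻¹ (inv_pos.2 hm0)).2
        (by rw [inv_mul_le_one₀ hm0]; exact (le_max_left _ _).trans hm1.le)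
      rw [inv_mul_le_one₀ hm0] at h1
      linarith
  exact ContinuousLinearMap.ext fun x ↦ le_antisymm (key h.symm x) (key h x)

/-- Functionals of norm one with a bounded polyhedron give an `n`-gon circumscribed about the unit
circle. -/
lemma isCircumscribedNGon_poly [FiniteDimensional ℝ V] (hG : ∀ g ∈ G, ‖g‖ = 1)
    (hb : IsBounded (poly G (0 : V))) : IsCircumscribedNGon G.card (poly G (0 : V)) 0 1 := by
  refine ⟨hb, (fun g : V →L[ℝ] ℝ ↦ {x | g x ≤ 1}) '' G, G.finite_toSet.image _, ?_, ?_, ?_⟩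
  · rw [ncard_image_of_injective _ fun g g' h ↦ eq_of_halfPlane_eq h, ncard_coe_finset]
  · rintro _ ⟨g, hg, rfl⟩
    have h1 := hG g hg
    refine ⟨g, 1, by rintro rfl; simp at h1, rfl, fun x hx ↦ ?_, ?_⟩
    · rw [mem_closedBall_zero_iff] at hx
      exact (le_abs_self _).trans ((g.le_opNorm x).trans (by rwa [h1, one_mul]))
    · obtain ⟨x, hx, hgx⟩ := exists_mem_closedBall_apply_eq_norm g
      exact ⟨x, hx, hgx.trans h1⟩
  · ext x
    simp [poly]

lemma sum_image_union {ι α M : Type*} [Fintype ι] [DecidableEq α] [AddCommMonoid M] {g : ι → α}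
    (hg : Function.Injective g) {E : Finset α} (hd : Disjoint (Finset.univ.image g) E)
    (k : α → M) : ∑ a ∈ Finset.univ.image g ∪ E, k a = ∑ i, k (g i) + ∑ a ∈ E, k a := by
  rw [Finset.sum_union hd, Finset.sum_image hg.injOn]

variable (e : Module.Basis (Fin 2) ℝ V)

lemma continuous_dualToPlane : Continuous (dualToPlane e) := by
  unfold dualToPlane
  fun_prop

/-- Radial projection maps the line through g₀ in the direction g₁ injectively to the unit sphere.
This supplies arbitrarily many extra sides close to a given one. -/
lemma infinite_norm_eq_one_inter {g₀ g₁ : V →L[ℝ] ℝ} (h₀ : ‖g₀‖ = 1)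
    (hind : g₀ (dualToPlane e g₁) ≠ 0) {U : Set (V →L[ℝ] ℝ)} (hU : U ∈ nhds g₀) :
    {g | g ∈ U ∧ ‖g‖ = 1}.Infinite := by
  have hind' : g₁ (dualToPlane e g₀) ≠ 0 := by
    rw [apply_dualToPlane_swap]; exact neg_ne_zero.2 hind
  have hne : ∀ t : ℝ, g₀ + t • g₁ ≠ 0 := fun t ht ↦ by
    have := DFunLike.congr_fun ht (dualToPlane e g₁)
    simp only [add_apply, smul_apply, apply_dualToPlane_self, smul_eq_mul, mul_zero, add_zero,
      zero_apply] at this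
    exact hind this
  set φ : ℝ → (V →L[ℝ] ℝ) := fun t ↦ ‖g₀ + t • g₁‖⁻¹ • (g₀ + t • g₁) with hφ
  have hφc : Continuous φ := by
    refine Continuous.smul (Continuous.inv₀ (by fun_prop) fun t ↦ norm_ne_zero_iff.2 (hne t))
      (by fun_prop)
  have hφ0 : φ 0 = g₀ := by simp [hφ, h₀]
  have hφinj : Function.Injective φ := by
    intro s t hst
    have h1 := DFunLike.congr_fun hst (dualToPlane e g₁)
    have h2 := DFunLike.congr_fun hst (dualToPlane e g₀)
    simp only [hφ, add_apply, smul_apply, apply_dualToPlane_self, smul_eq_mul, mul_zero, add_zero,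
      zero_add] at h1 h2
    rw [mul_right_cancel₀ hind h1] at h2
    exact mul_right_cancel₀ hind' (mul_left_cancel₀ (inv_ne_zero (norm_ne_zero_iff.2 (hne t))) h2)
  have hinf : (φ ⁻¹' U).Infinite :=
    infinite_of_mem_nhds 0 (hφc.continuousAt.preimage_mem_nhds (by rwa [hφ0]))
  refine (hinf.image hφinj.injOn).mono ?_
  rintro _ ⟨t, ht, rfl⟩
  refine ⟨ht, ?_⟩
  rw [hφ, norm_smul, norm_inv, norm_norm, inv_mul_cancel₀ (norm_ne_zero_iff.2 (hne t))]

/-- The nonnegative numbers l_i (1 - g_i x) have the fixed sum S, which bounds each g_i x; Cramer's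
rule then bounds x. -/
lemma isBounded_poly_of_sum_eq_zero {g : Fin 3 → (V →L[ℝ] ℝ)} {l : Fin 3 → ℝ} (hl : ∀ i, 0 < l i)
    (hsum : ∑ i, l i • g i = 0) (hind : g 0 (dualToPlane e (g 1)) ≠ 0) (hG : ∀ i, g i ∈ G) :
    IsBounded (poly G (0 : V)) := by
  set S := ∑ i, l i with hS
  have hbd : ∀ i, ∀ x ∈ poly G (0 : V), |g i x| ≤ 1 + S / l i := by
    intro i x hx
    have hle : ∀ j, g j x ≤ 1 := fun j ↦ by simpa using hx _ (hG j)
    have h1 : ∑ j, l j * g j x = 0 := by simpa using DFunLike.congr_fun hsum x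
    have h2 : l i * (1 - g i x) ≤ ∑ j, l j * (1 - g j x) :=
      Finset.single_le_sum (f := fun j ↦ l j * (1 - g j x))
        (fun j _ ↦ mul_nonneg (hl j).le (sub_nonneg.2 (hle j))) (Finset.mem_univ i)
    simp only [mul_sub, mul_one, Finset.sum_sub_distrib, h1, sub_zero, ← hS] at h2
    have h3 : 0 ≤ S / l i :=
      div_nonneg (Finset.sum_nonneg fun j _ ↦ (hl j).le) (hl i).le
    have h4 : 1 - g i x ≤ S / l i := by
      rw [le_div_iff₀ (hl i)]
      linarith
    rw [abs_le]
    constructor <;> linarith [hle i]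
  set d := g 0 (dualToPlane e (g 1))
  refine (isBounded_iff_subset_closedBall 0).2 ⟨((1 + S / l 0) * ‖dualToPlane e (g 1)‖ +
    (1 + S / l 1) * ‖dualToPlane e (g 0)‖) / |d|, fun x hx ↦ ?_⟩
  rw [mem_closedBall_zero_iff, le_div_iff₀ (abs_pos.2 hind), mul_comm, ← Real.norm_eq_abs,
    ← norm_smul, cramer]
  refine (norm_sub_le _ _).trans ?_
  rw [norm_smul, norm_smul, Real.norm_eq_abs, Real.norm_eq_abs]
  gcongr
  exacts [hbd 0 x hx, hbd 1 x hx]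

variable [FiniteDimensional ℝ V] [MeasurableSpace V] [BorelSpace V]

/-- A continuous function on the dual whose sums over the sides of the `n`-gons circumscribed about
the unit circle, weighted by their lengths, vanish has the same property for triangles. -/
lemma sum_eq_zero_of_nGon (μ : Measure V) [μ.IsAddHaarMeasure] {n : ℕ} (hn : 3 ≤ n)
    {h : (V →L[ℝ] ℝ) → ℝ} (hc : Continuous h)
    (H : ∀ G : Finset (V →L[ℝ] ℝ), G.card = n → (∀ g ∈ G, ‖g‖ = 1) → IsBounded (poly G (0 : V)) →
      ∑ g ∈ G, diam (face G (0 : V) g) / ‖dualToPlane e g‖ * h g = 0)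
    {g : Fin 3 → (V →L[ℝ] ℝ)} {l : Fin 3 → ℝ} (hg : ∀ i, ‖g i‖ = 1) (hl : ∀ i, 0 < l i)
    (hsum : ∑ i, l i • g i = 0) (hind : ∀ i j, i ≠ j → g i (dualToPlane e (g j)) ≠ 0) :
    ∑ i, l i * h (g i) = 0 := by
  classical
  have hginj : Function.Injective g := by
    intro i j hij
    by_contra hne
    exact hind i j hne (by rw [hij, apply_dualToPlane_self])
  set T := Finset.univ.image g with hT
  have hTcard : T.card = 3 := by rw [hT, Finset.card_image_of_injective _ hginj]; rfl
  have hTb : IsBounded (poly T (0 : V)) := isBounded_poly_of_sum_eq_zero e hl hsum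
    (hind 0 1 (by decide)) fun i ↦ Finset.mem_image_of_mem g (Finset.mem_univ i)
  set κ := μ.real (refTriangle e) with hκ
  have hκ0 : 0 < κ := measureReal_refTriangle_pos e μ
  set lo := μ.real (closedBall (0 : V) 1) / κ with hlo
  set hi := μ.real (poly T (0 : V)) / κ with hhi
  have hlo0 : 0 < lo := div_pos (ENNReal.toReal_pos (measure_closedBall_pos μ 0 one_pos).ne'
    isBounded_closedBall.measure_lt_top.ne) hκ0
  have hhi0 : 0 ≤ hi := div_nonneg measureReal_nonneg hκ0.le
  -- Candidate weights of the three sides. The bounds come from the areas of the unit disc and of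
  -- the triangle, so C is compact and excludes 0.
  set C : Set (Fin 3 → ℝ) := {X | (∀ i, 0 ≤ X i) ∧ lo ≤ ∑ i, X i ∧ ∑ i, X i ≤ hi} with hC
  set F : (Fin 3 → ℝ) → ℝ := fun X ↦ ‖∑ i, X i • g i‖ + |∑ i, X i * h (g i)| with hF
  have happrox : ∀ ε > 0, ∃ X ∈ C, F X ≤ ε * hi + ε * hi := by
    intro ε hε
    have hU : {f | dist f (g 0) < ε ∧ dist (h f) (h (g 0)) < ε} ∈ nhds (g 0) :=
      Filter.inter_mem (ball_mem_nhds _ hε)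
        (hc.continuousAt.preimage_mem_nhds (ball_mem_nhds _ hε))
    -- The n - 3 additional sides are taken within ε of `g 0`, both as functionals and in the values
    -- of h.
    obtain ⟨E, hE, hEcard⟩ := ((infinite_norm_eq_one_inter e (hg 0) (hind 0 1 (by decide))
      hU).sdiff T.finite_toSet).exists_subset_card_eq (n - 3)
    have hdisj : Disjoint T E := Finset.disjoint_right.2 fun f hf hfT ↦ (hE hf).2 hfT
    set G := T ∪ E with hG
    have hGcard : G.card = n := by
      rw [hG, Finset.card_union_of_disjoint hdisj, hTcard, hEcard]; omega
    have hG1 : ∀ f ∈ G, ‖f‖ = 1 := by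
      intro f hf
      rcases Finset.mem_union.1 hf with hf | hf
      · obtain ⟨i, -, rfl⟩ := Finset.mem_image.1 hf
        exact hg i
      · exact (hE hf).1.2
    have hG0 : ∀ f ∈ G, f ≠ 0 := by
      rintro f hf rfl
      have := hG1 0 hf
      simp at this
    have hsub : poly G (0 : V) ⊆ poly T 0 := fun x hx f hf ↦ hx f (Finset.mem_union_left _ hf)
    have hGb := hTb.subset hsub
    set τ : (V →L[ℝ] ℝ) → ℝ := fun f ↦ diam (face G (0 : V) f) / ‖dualToPlane e f‖ with hτ
    have hτ0 : ∀ f, 0 ≤ τ f := fun f ↦ div_nonneg diam_nonneg (norm_nonneg _)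
    have hτE : 0 ≤ ∑ f ∈ E, τ f := Finset.sum_nonneg fun f _ ↦ hτ0 f
    have harea : ∑ f ∈ G, τ f = μ.real (poly G (0 : V)) / κ := by
      rw [measureReal_poly_center e μ hG0 hGb, mul_div_cancel_left₀ _ hκ0.ne']
    have hclosed : ∑ f ∈ G, τ f • f = 0 := sum_sides_eq_zero e μ hG0 hGb
    have hzero : ∑ f ∈ G, τ f * h f = 0 := H G hGcard hG1 hGb
    rw [sum_image_union hginj hdisj] at harea hclosed hzero
    have hEle : ∑ f ∈ E, τ f ≤ hi := by
      have h1 : ∑ f ∈ E, τ f ≤ μ.real (poly G (0 : V)) / κ := by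
        rw [← harea]
        have : 0 ≤ ∑ i, τ (g i) := Finset.sum_nonneg fun i _ ↦ hτ0 _
        linarith
      refine h1.trans (div_le_div_of_nonneg_right ?_ hκ0.le)
      exact measureReal_mono hsub hTb.measure_lt_top.ne
    -- The weight of the extra sides is credited to `g 0`; the error is at most ε times their total
    -- weight.
    set X : Fin 3 → ℝ := fun i ↦ τ (g i) + if i = 0 then ∑ f ∈ E, τ f else 0 with hX
    have hXsum : ∑ i, X i = μ.real (poly G (0 : V)) / κ := by
      rw [← harea, hX, Finset.sum_add_distrib]
      simp
    refine ⟨X, ⟨fun i ↦ ?_, ?_, ?_⟩, ?_⟩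
    · refine add_nonneg (hτ0 _) ?_
      split_ifs
      exacts [hτE, le_rfl]
    · rw [hXsum]
      refine div_le_div_of_nonneg_right (measureReal_mono ?_ hGb.measure_lt_top.ne) hκ0.le
      exact closedBall_subset_poly fun f hf ↦ by rw [hG1 f hf, one_mul]
    · rw [hXsum]
      exact div_le_div_of_nonneg_right (measureReal_mono hsub hTb.measure_lt_top.ne) hκ0.le
    · have h1 : ∑ i, X i • g i = ∑ f ∈ E, τ f • (g 0 - f) := by
        simp only [hX, add_smul, ite_smul, zero_smul, Finset.sum_add_distrib, Finset.sum_ite_eq',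
          Finset.mem_univ, if_true, smul_sub, Finset.sum_sub_distrib, Finset.sum_smul]
        rw [eq_sub_iff_add_eq, add_right_comm, hclosed, zero_add]
      have h2 : ∑ i, X i * h (g i) = ∑ f ∈ E, τ f * (h (g 0) - h f) := by
        simp only [hX, add_mul, ite_mul, zero_mul, Finset.sum_add_distrib, Finset.sum_ite_eq',
          Finset.mem_univ, if_true, mul_sub, Finset.sum_sub_distrib, Finset.sum_mul]
        linarith
      have hfin : ∑ f ∈ E, τ f * ε ≤ ε * hi := by
        rw [← Finset.sum_mul, mul_comm]
        gcongr
      refine add_le_add ?_ ?_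
      · rw [h1]
        refine (norm_sum_le_of_le _ fun f hf ↦ ?_).trans hfin
        rw [norm_smul, Real.norm_of_nonneg (hτ0 f)]
        refine mul_le_mul_of_nonneg_left ?_ (hτ0 f)
        rw [← dist_eq_norm, dist_comm]
        exact (hE hf).1.1.1.le
      · rw [h2, ← Real.norm_eq_abs]
        refine (norm_sum_le_of_le _ fun f hf ↦ ?_).trans hfin
        rw [norm_mul, Real.norm_of_nonneg (hτ0 f)]
        refine mul_le_mul_of_nonneg_left ?_ (hτ0 f)
        rw [← dist_eq_norm, dist_comm]
        exact (hE hf).1.1.2.le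
  have hCc : IsCompact C := by
    refine (isCompact_Icc (a := (0 : Fin 3 → ℝ)) (b := fun _ ↦ hi)).of_isClosed_subset ?_ ?_
    · have hsc : Continuous fun X : Fin 3 → ℝ ↦ ∑ i, X i := by fun_prop
      exact (isClosed_Ici (a := (0 : Fin 3 → ℝ))).inter
        ((isClosed_le continuous_const hsc).inter (isClosed_le hsc continuous_const))
    · rintro X ⟨hX0, -, hX⟩
      exact ⟨hX0, fun i ↦ (Finset.single_le_sum (fun j _ ↦ hX0 j) (Finset.mem_univ i)).trans hX⟩
  have hFc : Continuous F := by fun_prop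
  obtain ⟨X₁, hX₁, -⟩ := happrox 1 one_pos
  obtain ⟨X, ⟨-, hXlo, -⟩, hmin⟩ := hCc.exists_isMinOn ⟨X₁, hX₁⟩ hFc.continuousOn
  have hFX : F X ≤ 0 := by
    refine le_of_forall_pos_le_add fun η hη ↦ ?_
    obtain ⟨Y, hY, hFY⟩ := happrox (η / (2 * hi + 1)) (by positivity)
    have h1 : F X ≤ F Y := hmin hY
    have h2 : η / (2 * hi + 1) * hi + η / (2 * hi + 1) * hi ≤ η := by
      rw [← mul_add, div_mul_eq_mul_div, div_le_iff₀ (by positivity)]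
      nlinarith
    linarith
  have hn0 := norm_nonneg (∑ i, X i • g i)
  have ha0 := abs_nonneg (∑ i, X i * h (g i))
  have hXg : ∑ i, X i • g i = 0 := norm_eq_zero.1 (by simp only [hF] at hFX; linarith)
  have hXh : ∑ i, X i * h (g i) = 0 := abs_eq_zero.1 (by simp only [hF] at hFX; linarith)
  -- The linear relation between three pairwise independent functionals is unique up to the factor
  -- r, and r ≠ 0 by the lower area bound.
  set r := X 0 / l 0 with hr
  have hX0 : X 0 = r * l 0 := (div_mul_cancel₀ _ (hl 0).ne').symm
  have hX : ∀ i j, i ≠ 0 → j ≠ 0 → i ≠ j → X i = r * l i := by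
    intro i j hi0 hj0 hij
    have h1 := DFunLike.congr_fun hXg (dualToPlane e (g j))
    have h2 := DFunLike.congr_fun hsum (dualToPlane e (g j))
    have h3 := hind i j hij
    simp only [sum_apply, smul_apply, smul_eq_mul, zero_apply] at h1 h2
    have h4 : ∑ m, (X m - r * l m) * g m (dualToPlane e (g j)) = 0 := by
      simp only [sub_mul, mul_assoc, Finset.sum_sub_distrib, ← Finset.mul_sum, h1, h2]
      ring
    rw [Finset.sum_eq_single i] at h4
    · exact sub_eq_zero.1 ((mul_eq_zero.1 h4).resolve_right h3)
    · intro m _ hm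
      have : m = 0 ∨ m = j := by omega
      rcases this with rfl | rfl
      · rw [hX0, sub_self, zero_mul]
      · rw [apply_dualToPlane_self, mul_zero]
    · simp
  have hX1 := hX 1 2 (by decide) (by decide) (by decide)
  have hX2 := hX 2 1 (by decide) (by decide) (by decide)
  have hr0 : r ≠ 0 := by
    intro h0
    rw [Fin.sum_univ_three, hX0, hX1, hX2, h0] at hXlo
    linarith
  rw [Fin.sum_univ_three, hX0, hX1, hX2] at hXh
  rw [Fin.sum_univ_three]
  apply mul_left_cancel₀ hr0
  linarith

/-- If circumscribed `n`-gons satisfy the area formula, norm and antinorm are proportional. -/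
lemma norm_dualToPlane_eq_of_nGon (μ : Measure V) [μ.IsAddHaarMeasure] {γ : ℝ} {n : ℕ} (hn : 3 ≤ n)
    (H : ∀ (P : Set V) (c : V) (ρ : ℝ), 0 < ρ → IsCircumscribedNGon n P c ρ →
      ρ * perimeter P = γ * μ.real P) (g : V →L[ℝ] ℝ) :
    ‖dualToPlane e g‖ = γ * μ.real (refTriangle e) * ‖g‖ := by
  set κ := μ.real (refTriangle e) with hκ
  set h : (V →L[ℝ] ℝ) → ℝ := fun g ↦ ‖dualToPlane e g‖ - γ * κ * ‖g‖ with hh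
  have hc : Continuous h :=
    (continuous_dualToPlane e).norm.sub (continuous_const.mul continuous_norm)
  have hsmul : ∀ (t : ℝ) g, h (t • g) = |t| * h g := fun t g ↦ by
    simp only [hh, dualToPlane_smul, norm_smul, Real.norm_eq_abs]
    ring
  have hneg : ∀ g, h (-g) = h g := fun g ↦ by
    simp only [hh, dualToPlane_neg, norm_neg]
  have hpoly : ∀ G : Finset (V →L[ℝ] ℝ), G.card = n → (∀ g ∈ G, ‖g‖ = 1) →
      IsBounded (poly G (0 : V)) →
      ∑ g ∈ G, diam (face G (0 : V) g) / ‖dualToPlane e g‖ * h g = 0 := by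
    intro G hG hG1 hb
    have h0 : ∀ g ∈ G, g ≠ 0 := by
      rintro g hg rfl
      have := hG1 0 hg
      simp at this
    have h1 := H _ 0 1 one_pos (hG ▸ isCircumscribedNGon_poly hG1 hb)
    rw [perimeter_poly e h0, measureReal_poly_center e μ h0 hb, one_mul, ← mul_assoc,
      ← hκ, Finset.mul_sum, ← sub_eq_zero, ← Finset.sum_sub_distrib] at h1
    rw [← h1]
    refine Finset.sum_congr rfl fun g hg ↦ ?_
    have := (dualToPlane_pos e (h0 g hg)).ne'
    simp only [hh, hG1 g hg]
    field_simp
  have hadd : ∀ f₁ f₂ : V →L[ℝ] ℝ, f₁ (dualToPlane e f₂) ≠ 0 →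
      h f₁ + h f₂ + h (f₁ + f₂) = 0 := by
    intro f₁ f₂ h12
    have h21 : f₂ (dualToPlane e f₁) ≠ 0 := by
      rw [apply_dualToPlane_swap]; exact neg_ne_zero.2 h12
    set f : Fin 3 → (V →L[ℝ] ℝ) := ![f₁, f₂, -(f₁ + f₂)] with hf
    have hfind : ∀ i j, i ≠ j → f i (dualToPlane e (f j)) ≠ 0 := by
      intro i j hij
      fin_cases i <;> fin_cases j <;>
        simp [hf, dualToPlane_neg, dualToPlane_add, h12, h21] at hij ⊢
    have hf0 : ∀ i, f i ≠ 0 := fun i hi ↦ by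
      obtain ⟨j, hj⟩ := exists_ne i
      exact hfind i j hj.symm (by rw [hi, zero_apply])
    have hfn : ∀ i, 0 < ‖f i‖ := fun i ↦ norm_pos_iff.2 (hf0 i)
    -- The side normals are f₁, f₂, -(f₁ + f₂) scaled to norm one; their norms serve as weights, and
    -- homogeneity of h cancels the scaling.
    have key := sum_eq_zero_of_nGon e μ hn hc hpoly (g := fun i ↦ ‖f i‖⁻¹ • f i)
      (l := fun i ↦ ‖f i‖)
      (fun i ↦ by rw [norm_smul, norm_inv, norm_norm, inv_mul_cancel₀ (hfn i).ne']) hfn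
      (by
        simp only [smul_smul, mul_inv_cancel₀ (hfn _).ne', one_smul]
        simp [hf, Fin.sum_univ_three])
      (fun i j hij ↦ by
        rw [dualToPlane_smul, map_smul, smul_apply, smul_eq_mul, smul_eq_mul]
        exact mul_ne_zero (inv_ne_zero (hfn j).ne')
          (mul_ne_zero (inv_ne_zero (hfn i).ne') (hfind i j hij)))
    simp only [hsmul, abs_inv, abs_norm, mul_inv_cancel_left₀ (hfn _).ne'] at key
    simpa [hf, Fin.sum_univ_three, hneg, -neg_add_rev] using key
  have heq : ∀ p q : V →L[ℝ] ℝ, p (dualToPlane e q) ≠ 0 → h p = h q := by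
    intro p q hpq
    -- Changing the sign of the half difference turns the sum from p into q but leaves the other two
    -- values of h unchanged.
    have h1 := hadd ((1 / 2 : ℝ) • (p + q)) ((1 / 2 : ℝ) • (p - q)) (by
      have h2 := apply_dualToPlane_swap e q p
      simp only [dualToPlane_smul, dualToPlane_sub, map_smul, map_sub, smul_apply, add_apply,
        apply_dualToPlane_self, smul_eq_mul, h2]
      intro h0
      exact hpq (by linarith))
    have h2 := hadd ((1 / 2 : ℝ) • (p + q)) (-((1 / 2 : ℝ) • (p - q))) (by
      have h2 := apply_dualToPlane_swap e q p
      simp only [dualToPlane_neg, dualToPlane_smul, dualToPlane_sub, map_neg, map_smul, map_sub,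
        smul_apply, add_apply, apply_dualToPlane_self, smul_eq_mul, h2]
      intro h0
      exact hpq (by linarith))
    have h3 : (1 / 2 : ℝ) • (p + q) + (1 / 2 : ℝ) • (p - q) = p := by module
    have h4 : (1 / 2 : ℝ) • (p + q) + -((1 / 2 : ℝ) • (p - q)) = q := by module
    rw [h3] at h1
    rw [h4, hneg] at h2
    linarith
  have hzero : h g = 0 := by
    rcases eq_or_ne g 0 with rfl | hg
    · simp [hh, dualToPlane]
    · obtain ⟨f, hf1, hf2⟩ := exists_dual_vector ℝ (dualToPlane e g) (dualToPlane_pos e hg).ne'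
      have hf : f (dualToPlane e g) ≠ 0 := by
        rw [hf2]
        simpa using dualToPlane_ne_zero e hg
      have h1 := heq f g hf
      -- Both g and 2g are independent of f, so h(g) = h(f) = h(2g) = 2 h(g).
      have h2 := heq f ((2 : ℝ) • g) (by
        rw [dualToPlane_smul, map_smul, smul_eq_mul]
        exact mul_ne_zero two_ne_zero hf)
      rw [hsmul, abs_of_pos two_pos] at h2
      linarith
  simp only [hh] at hzero
  linarith

end

end MinkowskiPlane

end

/-! ### The equivalence -/

open MinkowskiPlane in
/-- The area is given by a translation-invariant measure `μ`, i.e. a choice of the unit of area. -/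
theorem corollary9p3 {V : Type*} [NormedAddCommGroup V] [NormedSpace ℝ V]
    (hV : Module.finrank ℝ V = 2) [MeasurableSpace V] [BorelSpace V]
    (μ : Measure V) [μ.IsAddHaarMeasure] :
    List.TFAE [
      IsRadon V,
      ∃ γ : ℝ, 0 < γ ∧ ∀ (P : Set V) (c : V) (ρ : ℝ), 0 < ρ →
        IsConvexPolygon P → IsCircumscribed P c ρ →
          ρ * perimeter P = γ * μ.real P,
      ∃ γ : ℝ, 0 < γ ∧ ∃ n : ℕ, 3 ≤ n ∧ ∀ (P : Set V) (c : V) (ρ : ℝ), 0 < ρ →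
        IsCircumscribedNGon n P c ρ →
          ρ * perimeter P = γ * μ.real P,
      ∃ γ : ℝ, 0 < γ ∧ ∀ (P : Set V) (c : V) (ρ : ℝ), 0 < ρ →
        IsTriangle P → IsCircumscribed P c ρ →
          ρ * perimeter P = γ * μ.real P] := by
  have : FiniteDimensional ℝ V := Module.finite_of_finrank_pos (by omega)
  let e : Module.Basis (Fin 2) ℝ V := Module.finBasisOfFinrankEq ℝ V hV
  tfae_have 1 → 2 := fun hR ↦ by
    obtain ⟨k, hk, h⟩ := hR.exists_norm_dualToPlane_eq e
    exact ⟨k / μ.real (refTriangle e), div_pos hk (measureReal_refTriangle_pos e μ),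
      fun P c ρ hρ hP hc ↦ perimeter_eq_of_norm_dualToPlane μ e hk h hρ hP hc⟩
  tfae_have 2 → 4 := fun ⟨γ, hγ, H⟩ ↦
    ⟨γ, hγ, fun P c ρ hρ hP hc ↦ H P c ρ hρ (hP.isConvexPolygon hV) hc⟩
  tfae_have 4 → 3 := fun ⟨γ, hγ, H⟩ ↦ ⟨γ, hγ, 3, le_rfl, fun P c ρ hρ hP ↦
    H P c ρ hρ (hP.isTriangle μ e hρ) (hP.isCircumscribed hρ e)⟩
  tfae_have 3 → 1 := fun ⟨_, _, _, hn, H⟩ ↦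
    isRadon_of_norm_dualToPlane e (norm_dualToPlane_eq_of_nGon e μ hn H)
  tfae_finish
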